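/- Write $\mathsf Z_n$ for the cyclic group of order $n$, $\mathrm D_{2n}$ for the dihedral group of order $2n$, $x^y=y^{-1}xy$, and $\mathsf{Hol}(N)=N{:}\mathrm{Aut}(N)$ for the holomorph of $N$. The notation $\langle a\rangle{:}\langle b\rangle$ means a split extension of $\langle a\rangle$ by $\langle b\rangle$. For groups $A,B$, subgroups $C_1\le Z(A)$, $C_2\le Z(B)$ of the centres and an isomorphism $\varphi:C_1\to C_2$, the central product is $(A\times B)/\{(c,c^\varphi)\mid c\in C_1\}$. In $\mathsf Z_{2^{\ell-2}}\circ\mathrm D_8$ $(\ell\ge 3)$ the subgroup of order $2$ of $\mathsf Z_{2^{\ell-2}}$ is identified with the centre of $\mathrm D_8$. Let $G$ be a finite $2$-group of order $|G|\ge 2^4$ that has a cyclic maximal subgroup. Then $G$ is one of the following groups, with the given presentation, where $\ell\ge 4$ in (1) and $\ell\ge 3$ in (2)–(6). Moreover, in each case, for any generators of $G$ that satisfy the given presentation, there are automorphisms of $G$ with the indicated values, they generate $\mathrm{Aut}(G)$, and $\mathrm{Aut}(G)$ has the indicated structure. 1. $G=\mathsf Z_{2^\ell}=\langle a\mid a^{2^\ell}=1\rangle$;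 $\mathrm{Aut}(G)=\langle\rho_5,\rho_{-1}\rangle$, where $a^{\rho_x}=a^x$; $\mathrm{Aut}(G)\cong\mathsf Z_{2^{\ell-2}}\times\mathsf Z_2$. 2. $G=\mathsf Z_{2^\ell}\times\mathsf Z_2=\langle a,b\mid a^{2^\ell}=b^2=1,\ a^b=a\rangle$; $\mathrm{Aut}(G)=\langle\rho_5,\rho_{-1},\tau,\sigma\rangle$, where $(a,b)^{\rho_x}=(a^x,b)$, $(a,b)^\tau=(ab,b)$, $(a,b)^\sigma=(a,a^{2^{\ell-1}}b)$; $\mathrm{Aut}(G)\cong(\mathsf Z_{2^{\ell-2}}\circ\mathrm D_8)\times\mathsf Z_2$. 3. $G=\mathrm D_{2^{\ell+1}}=\langle a,b\mid a^{2^\ell}=b^2=1,\ a^b=a^{-1}\rangle$ (dihedral); $\mathrm{Aut}(G)=\langle\rho_5,\rho_{-1},\eta\rangle$, where $(a,b)^{\rho_x}=(a^x,b)$, $(a,b)^\eta=(a,ab)$; $\mathrm{Aut}(G)\cong\mathsf{Hol}(\mathsf Z_{2^\ell})$. 4. $G=\mathrm{SD}_{2^{\ell+1}}=\langle a,b\mid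 a^{2^\ell}=b^2=1,\ a^b=a^{2^{\ell-1}-1}\rangle=\langle a\rangle{:}\langle b\rangle$ with $|a|=2^\ell$, $|b|=2$ (semidihedral); $\mathrm{Aut}(G)=\langle\rho_5,\rho_{-1},\eta_0\rangle$, where $(a,b)^{\rho_x}=(a^x,b)$, $(a,b)^{\eta_0}=(a,a^2b)$; $\mathrm{Aut}(G)\cong\mathsf Z_{2^{\ell-1}}{:}\mathrm{Aut}(\mathsf Z_{2^\ell})$, where the automorphism $x\mapsto x^i$ of $\mathsf Z_{2^\ell}$ ($i$ odd) acts on $\mathsf Z_{2^{\ell-1}}$ by $x\mapsto x^i$. 5. $G=\mathsf Z_{2^\ell}{:}\mathsf Z_2=\langle a,b\mid a^{2^\ell}=b^2=1,\ a^b=a^{2^{\ell-1}+1}\rangle=\langle a\rangle{:}\langle b\rangle$ with $|a|=2^\ell$, $|b|=2$ (modular); $\mathrm{Aut}(G)=\langle\rho_5,\rho_{-1},\tau,\sigma\rangle$, where $(a,b)^{\rho_x}=(a^x,b)$, $(a,b)^\tau=(ab,b)$, $(a,b)^\sigma=(a,a^{2^{\ell-1}}b)$; $\mathrm{Aut}(G)\cong(\mathsf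 Z_{2^{\ell-2}}\circ\mathrm D_8)\times\mathsf Z_2$. 6. $G=\mathrm Q_{2^{\ell+1}}=\langle a,c\mid a^{2^\ell}=1,\ a^{2^{\ell-1}}=c^2,\ a^c=a^{-1}\rangle$ (generalized quaternion); $\mathrm{Aut}(G)=\langle\rho_5,\rho_{-1},\eta\rangle$, where $(a,c)^{\rho_x}=(a^x,c)$, $(a,c)^\eta=(a,ac)$; $\mathrm{Aut}(G)\cong\mathsf{Hol}(\mathsf Z_{2^\ell})$. In particular, if $G$ is generated by involutions, then $G$ is dihedral (isomorphic to $\mathrm D_{2^{\ell+1}}$ for some $\ell\ge 3$). -/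

import Mathlib

/-- The cyclic group of order `n`, written multiplicatively. -/
abbrev Cyc (n : ℕ) : Type := Multiplicative (ZMod n)

/-- The family `g` of elements of `G` is a generating set of `G` with defining relators `rels`:
the homomorphism from the free group sending the free generators to `g` is onto, and its
kernel is the normal closure of `rels`. -/
def IsPresentation {G ι : Type*} [Group G] (g : ι → G) (rels : Set (FreeGroup ι)) : Prop :=
  Function.Surjective (FreeGroup.lift g) ∧
    (FreeGroup.lift g).ker = Subgroup.normalClosure rels

/-- The relators of `⟨a | a ^ (2 ^ ℓ) = 1⟩`. -/
def cyclicRels (ℓ : ℕ) : Set (FreeGroup (Fin 1)) :=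
  {FreeGroup.of 0 ^ 2 ^ ℓ}

/-- The relators of `⟨a, b | a ^ (2 ^ ℓ) = b ^ 2 = 1, b⁻¹ a b = a ^ k⟩`. -/
def splitRels (ℓ : ℕ) (k : ℤ) : Set (FreeGroup (Fin 2)) :=
  {FreeGroup.of 0 ^ 2 ^ ℓ, FreeGroup.of 1 ^ 2,
    (FreeGroup.of 1)⁻¹ * FreeGroup.of 0 * FreeGroup.of 1 * (FreeGroup.of 0 ^ k)⁻¹}

/-- The relators of `⟨a, c | a ^ (2 ^ ℓ) = 1, a ^ (2 ^ (ℓ - 1)) = c ^ 2, c⁻¹ a c = a⁻¹⟩`. -/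
def quaternionRels (ℓ : ℕ) : Set (FreeGroup (Fin 2)) :=
  {FreeGroup.of 0 ^ 2 ^ ℓ, FreeGroup.of 0 ^ 2 ^ (ℓ - 1) * (FreeGroup.of 1 ^ 2)⁻¹,
    (FreeGroup.of 1)⁻¹ * FreeGroup.of 0 * FreeGroup.of 1 * FreeGroup.of 0}

/-- `G = ⟨a⟩ : ⟨b⟩` is a split extension of the cyclic group `⟨a⟩` of order `2 ^ ℓ` by the group
`⟨b⟩` of order `2`, with action `b⁻¹ a b = a ^ k`. -/
def IsCyclicSplit {G : Type*} [Group G] (ℓ : ℕ) (k : ℤ) (a b : G) : Prop :=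
  orderOf a = 2 ^ ℓ ∧ orderOf b = 2 ∧ (Subgroup.zpowers a).Normal ∧
    Subgroup.IsComplement' (Subgroup.zpowers a) (Subgroup.zpowers b) ∧ b⁻¹ * a * b = a ^ k

/-- The holomorph `N : Aut(N)`, with the tautological action. -/
abbrev Holomorph (N : Type*) [Group N] : Type _ :=
  N ⋊[MonoidHom.id (MulAut N)] MulAut N

/-- `Aut(Z_n)` is the group of units of `ℤ/n`, acting by multiplication. -/
def cycAutEquivUnits (n : ℕ) : MulAut (Cyc n) ≃* (ZMod n)ˣ :=
  (MulAutMultiplicative (ZMod n)).trans (ZMod.AddAutEquivUnits n).toMultiplicative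

/-- For `m ∣ n`, the natural action of `Aut(Z_n)` on `Z_m`: the automorphism `x ↦ x ^ i` of `Z_n`
acts on `Z_m` as `x ↦ x ^ i`. It is the action of `Aut(Z_n)` by restriction on the subgroup
of order `m` of `Z_n`. -/
def cycAutAction {m n : ℕ} (h : m ∣ n) : MulAut (Cyc n) →* MulAut (Cyc m) :=
  (cycAutEquivUnits m).symm.toMonoidHom.comp
    ((ZMod.unitsMap h).comp (cycAutEquivUnits n).toMonoidHom)

/-- The semidirect product `Z_{2 ^ (ℓ - 1)} : Aut(Z_{2 ^ ℓ})` with the natural action. -/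
abbrev HalfHolomorph (ℓ : ℕ) : Type :=
  Cyc (2 ^ (ℓ - 1)) ⋊[cycAutAction (pow_dvd_pow 2 (Nat.sub_le ℓ 1))] MulAut (Cyc (2 ^ ℓ))

/-- The data from which a central product of `A` and `B` is formed: subgroups `C₁`, `C₂` of the
centres and an isomorphism between them. -/
structure CentralAmalgam (A B : Type*) [Group A] [Group B] where
  C₁ : Subgroup A
  C₂ : Subgroup B
  le_center₁ : C₁ ≤ Subgroup.center A
  le_center₂ : C₂ ≤ Subgroup.center B
  φ : C₁ ≃* C₂

namespace CentralAmalgam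

/-- The subgroup `{(c, φ c) | c ∈ C₁}` of `A × B`. -/
def graph {A B : Type*} [Group A] [Group B] (D : CentralAmalgam A B) : Subgroup (A × B) :=
  (D.C₁.subtype.prod (D.C₂.subtype.comp D.φ.toMonoidHom)).range

instance graph_normal {A B : Type*} [Group A] [Group B] (D : CentralAmalgam A B) :
    D.graph.Normal where
  conj_mem := by
    rintro _ ⟨c, rfl⟩ ⟨x, y⟩
    refine ⟨c, ?_⟩
    have h₁ := Subgroup.mem_center_iff.1 (D.le_center₁ c.2) x
    have h₂ := Subgroup.mem_center_iff.1 (D.le_center₂ (D.φ c).2) y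
    ext
    · simp [h₁]
    · simp [h₂]

/-- The central product `(A × B) / {(c, φ c)}`. -/
abbrev Product {A B : Type*} [Group A] [Group B] (D : CentralAmalgam A B) : Type _ :=
  (A × B) ⧸ D.graph

end CentralAmalgam

/-- `X` is isomorphic to `(Z_{2 ^ (ℓ - 2)} ∘ D_8) × Z_2`, where the central product amalgamates the
whole centre of `D_8` (which has order `2`) with the subgroup of order `2` of `Z_{2 ^ (ℓ - 2)}`. -/
def IsCycCentralD8TimesZ2 (ℓ : ℕ) (X : Type*) [Group X] : Prop :=
  ∃ D : CentralAmalgam (Cyc (2 ^ (ℓ - 2))) (DihedralGroup 4),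
    D.C₂ = Subgroup.center (DihedralGroup 4) ∧ Nonempty (X ≃* D.Product × Cyc 2)

/-!
The groups with two generators in the list are all extensions of a cyclic group `⟨a⟩` of order
`n = 2 ^ ℓ` by a group of order `2`, with `b ^ 2 = a ^ e` and `b⁻¹ a b = a ^ k`. They are treated
uniformly through the predicate `IsCyclicExtension n k e a b`. By the relations every element has the
form `a ^ i` or `a ^ i * b`, so the predicate says that `G` is presented by the relations
(`IsCyclicExtension.isPresentation`); conversely, a presentation implies the predicate because there
is a model in which the relations do not collapse. The universal property of the presentation then
gives isomorphisms between two extensions with the same parameters, and automorphisms with prescribed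
values at `a` and `b`.

Classification: a cyclic maximal subgroup has index `2`, so a noncyclic `G` is such an extension.
Here `k` is one of the four square roots of `1` modulo `2 ^ ℓ`, and `e * (k - 1) = 0` modulo `2 ^ ℓ`;
replacing `b` by `a ^ s * b` changes `e` by `s * (1 + k)`, which leaves the listed cases
(`IsCyclicExtension.classification`).

Automorphisms: in the dihedral, semidihedral and quaternion groups the elements outside `⟨a⟩` have
order at most `4`, so `⟨a⟩` is characteristic, and an automorphism is given by a unit modulo `2 ^ ℓ`
and an exponent `j` with `b ↦ a ^ j * b`; this is a semidirect product
(`IsCyclicExtension.mulAut_semidirect`). In `Z_{2 ^ ℓ} × Z_2` and in the modular group, `σ` and `τ`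
are involutions whose commutator is the involution of `⟨ρ₅⟩`, and they commute with `ρ₅`; so
`⟨σ, τ⟩ = D_8` and `⟨ρ₅, σ, τ⟩ = Z_{2 ^ (ℓ - 2)} ∘ D_8`. The direct factor `Z_2` is generated by `ρ₋₁`
in the abelian group and by `ρ₋₁ σ` in the modular group (`IsCyclicExtension.mulAut_central`).

Involutions: in all cases but the dihedral one, they lie in a proper subgroup, namely the kernel of
the homomorphism with `a ↦ -1`, `b ↦ 1` (`IsCyclicExtension.closure_involutions_ne_top`), or, if `G`
is cyclic, the subgroup of order `2`.
-/

/-! ### Pairs of generators of a cyclic extension -/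

/-- The elements `a`, `b` satisfy the relations `a ^ n = 1`, `b ^ 2 = a ^ e`, `b⁻¹ a b = a ^ k`.
All the presentations on two generators that occur here are of this form; the exponents are
integers, of which only the classes modulo `n` matter. -/
structure ExtensionRel {G : Type*} [Group G] (n : ℕ) (k e : ℤ) (a b : G) : Prop where
  pow_eq_one : a ^ n = 1
  sq_eq : b ^ 2 = a ^ e
  conj_eq : b⁻¹ * a * b = a ^ k

/-- `G` is an extension of its cyclic subgroup `⟨a⟩`, of order exactly `n`, by a group of order `2`
generated by the class of `b`, with `b ^ 2 = a ^ e` and `b⁻¹ a b = a ^ k`. -/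
structure IsCyclicExtension {G : Type*} [Group G] (n : ℕ) (k e : ℤ) (a b : G) : Prop
    extends ExtensionRel n k e a b where
  orderOf_eq : orderOf a = n
  notMem : b ∉ Subgroup.zpowers a
  closure_eq : Subgroup.closure {a, b} = ⊤

namespace ExtensionRel

variable {G : Type*} [Group G] {n : ℕ} {k e : ℤ} {a b : G}

lemma zpow_eq_zpow (h : ExtensionRel n k e a b) {i j : ℤ} (hij : (n : ℤ) ∣ i - j) :
    a ^ i = a ^ j := by
  obtain ⟨t, ht⟩ := hij
  rw [show i = j + n * t by omega, zpow_add, zpow_mul, zpow_natCast, h.pow_eq_one, one_zpow,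
    mul_one]

lemma conj_zpow (h : ExtensionRel n k e a b) (i : ℤ) : b⁻¹ * a ^ i * b = a ^ (k * i) := by
  have := _root_.conj_zpow (i := i) (a := b⁻¹) (b := a)
  rw [inv_inv, h.conj_eq] at this
  rw [← this, zpow_mul]

/-- Conjugation by `b ^ 2 = a ^ e` is trivial on `⟨a⟩`. -/
lemma zpow_mul_mul (h : ExtensionRel n k e a b) (i : ℤ) : a ^ (k * (k * i)) = a ^ i := by
  rw [← h.conj_zpow, ← h.conj_zpow]
  have : b⁻¹ * (b⁻¹ * a ^ i * b) * b = (b ^ 2)⁻¹ * a ^ i * b ^ 2 := by rw [pow_two]; group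
  rw [this, h.sq_eq]
  group

lemma mul_zpow (h : ExtensionRel n k e a b) (i : ℤ) : b * a ^ i = a ^ (k * i) * b := by
  have := h.conj_zpow (k * i)
  rw [h.zpow_mul_mul] at this
  rw [← this]
  group

lemma zpow_mul_mul_zpow_mul (h : ExtensionRel n k e a b) (i j : ℤ) :
    a ^ i * b * (a ^ j * b) = a ^ (i + k * j + e) := by
  rw [mul_assoc, ← mul_assoc b, h.mul_zpow, mul_assoc, ← pow_two, h.sq_eq, zpow_add, zpow_add,
    mul_assoc]

lemma zpow_mul_sq (h : ExtensionRel n k e a b) (i : ℤ) :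
    (a ^ i * b) ^ 2 = a ^ (i * (1 + k) + e) := by
  rw [pow_two, h.zpow_mul_mul_zpow_mul]
  congr 1
  ring

lemma zpow_mul_zpow_two_mul (h : ExtensionRel n k e a b) (i j : ℤ) :
    (a ^ i * b) ^ (2 * j) = a ^ ((i * (1 + k) + e) * j) := by
  rw [zpow_mul, zpow_ofNat, h.zpow_mul_sq, zpow_mul a]

lemma exists_zpow_of_mem_closure (h : ExtensionRel n k e a b) {g : G}
    (hg : g ∈ Subgroup.closure {a, b}) : ∃ i : ℤ, g = a ^ i ∨ g = a ^ i * b := by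
  induction hg using Subgroup.closure_induction with
  | mem x hx =>
    rcases hx with rfl | rfl
    · exact ⟨1, .inl (zpow_one _).symm⟩
    · exact ⟨0, .inr (by simp)⟩
  | one => exact ⟨0, .inl (by simp)⟩
  | mul x y _ _ hx hy =>
    obtain ⟨i, rfl | rfl⟩ := hx <;> obtain ⟨j, rfl | rfl⟩ := hy
    · exact ⟨i + j, .inl (zpow_add ..).symm⟩
    · exact ⟨i + j, .inr (by rw [zpow_add, mul_assoc])⟩
    · exact ⟨i + k * j, .inr (by rw [mul_assoc, h.mul_zpow, zpow_add, mul_assoc])⟩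
    · exact ⟨_, .inl (h.zpow_mul_mul_zpow_mul i j)⟩
  | inv x _ hx =>
    obtain ⟨i, rfl | rfl⟩ := hx
    · exact ⟨-i, .inl (zpow_neg ..).symm⟩
    · refine ⟨- (i * k) - e, .inr ?_⟩
      rw [inv_eq_iff_mul_eq_one, h.zpow_mul_mul_zpow_mul]
      rw [show i + k * (-(i * k) - e) + e = i - k * (k * i) + (e - k * e) by ring, zpow_add,
        zpow_sub, h.zpow_mul_mul, mul_inv_cancel, one_mul, zpow_sub, ← h.conj_zpow, ← h.sq_eq]
      group

end ExtensionRel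

namespace IsCyclicExtension

variable {G H : Type*} [Group G] [Group H] {n : ℕ} {k e : ℤ} {a b : G}

lemma exists_zpow (h : IsCyclicExtension n k e a b) (g : G) :
    ∃ i : ℤ, g = a ^ i ∨ g = a ^ i * b :=
  h.exists_zpow_of_mem_closure (by rw [h.closure_eq]; trivial)

lemma zpow_eq_one_iff (h : IsCyclicExtension n k e a b) {i : ℤ} : a ^ i = 1 ↔ (n : ℤ) ∣ i := by
  rw [← orderOf_dvd_iff_zpow_eq_one, h.orderOf_eq]

lemma zpow_eq_zpow_iff (h : IsCyclicExtension n k e a b) {i j : ℤ} :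
    a ^ i = a ^ j ↔ (n : ℤ) ∣ i - j := by
  rw [← h.zpow_eq_one_iff, zpow_sub, mul_inv_eq_one]

lemma zpow_mul_ne_zpow (h : IsCyclicExtension n k e a b) (i j : ℤ) : a ^ i * b ≠ a ^ j := by
  intro hij
  refine h.notMem ⟨-i + j, ?_⟩
  simp only [zpow_add, ← hij]
  group

/-- Only the classes of `k` and `e` modulo `n` matter. -/
lemma congr_exponents (h : IsCyclicExtension n k e a b) {k' e' : ℤ} (hk : (n : ℤ) ∣ k - k')
    (he : (n : ℤ) ∣ e - e') : IsCyclicExtension n k' e' a b where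
  pow_eq_one := h.pow_eq_one
  sq_eq := by rw [h.sq_eq, h.zpow_eq_zpow he]
  conj_eq := by rw [h.conj_eq, h.zpow_eq_zpow hk]
  orderOf_eq := h.orderOf_eq
  notMem := h.notMem
  closure_eq := h.closure_eq

lemma congr_order (h : IsCyclicExtension n k e a b) {m : ℕ} (hm : n = m) :
    IsCyclicExtension m k e a b := hm ▸ h

lemma hom_ext (h : IsCyclicExtension n k e a b) {f g : G →* H} (ha : f a = g a) (hb : f b = g b) :
    f = g :=
  MonoidHom.eq_of_eqOn_dense h.closure_eq (by rintro x (rfl | rfl) <;> assumption)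

lemma mulAut_ext (h : IsCyclicExtension n k e a b) {f g : MulAut G} (ha : f a = g a)
    (hb : f b = g b) : f = g :=
  MulEquiv.toMonoidHom_injective (h.hom_ext (f := f.toMonoidHom) (g := g.toMonoidHom) ha hb)

end IsCyclicExtension

/-! ### Presentations -/

lemma IsPresentation.exists_lift {G H ι : Type*} [Group G] [Group H] {g : ι → G}
    {rels : Set (FreeGroup ι)} (h : IsPresentation g rels) (g' : ι → H)
    (hg' : ∀ r ∈ rels, FreeGroup.lift g' r = 1) : ∃ f : G →* H, ∀ i, f (g i) = g' i := by
  have hker : (FreeGroup.lift g).ker ≤ (FreeGroup.lift g').ker := by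
    rw [h.2]
    exact Subgroup.normalClosure_le_normal hg'
  refine ⟨(FreeGroup.lift g).liftOfSurjective h.1 ⟨FreeGroup.lift g', hker⟩, fun i ↦ ?_⟩
  have := (FreeGroup.lift g).liftOfRightInverse_comp_apply _ (Function.rightInverse_surjInv h.1)
    ⟨FreeGroup.lift g', hker⟩ (FreeGroup.of i)
  simpa using this

lemma IsPresentation.lift_eq_one {G ι : Type*} [Group G] {g : ι → G}
    {rels : Set (FreeGroup ι)} (h : IsPresentation g rels) {r : FreeGroup ι} (hr : r ∈ rels) :
    FreeGroup.lift g r = 1 := by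
  rw [← MonoidHom.mem_ker, h.2]
  exact Subgroup.subset_normalClosure hr

lemma IsPresentation.closure_range {G ι : Type*} [Group G] {g : ι → G}
    {rels : Set (FreeGroup ι)} (h : IsPresentation g rels) :
    Subgroup.closure (Set.range g) = ⊤ := by
  rw [← FreeGroup.range_lift_eq_closure, MonoidHom.range_eq_top]
  exact h.1

/-- The relators of `⟨a, b | a ^ n = 1, b ^ 2 = a ^ e, b⁻¹ a b = a ^ k⟩`. -/
def extensionRels (n : ℕ) (k e : ℤ) : Set (FreeGroup (Fin 2)) :=
  {FreeGroup.of 0 ^ n, FreeGroup.of 1 ^ 2 * (FreeGroup.of 0 ^ e)⁻¹,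
    (FreeGroup.of 1)⁻¹ * FreeGroup.of 0 * FreeGroup.of 1 * (FreeGroup.of 0 ^ k)⁻¹}

section

variable {G : Type*} [Group G] {a b : G}

lemma lift_extensionRels_iff {n : ℕ} {k e : ℤ} :
    (∀ r ∈ extensionRels n k e, FreeGroup.lift ![a, b] r = 1) ↔ ExtensionRel n k e a b := by
  simp only [extensionRels, Set.mem_insert_iff, Set.mem_singleton_iff, forall_eq_or_imp, forall_eq,
    map_mul, map_pow, map_inv, map_zpow, FreeGroup.lift_apply_of, Matrix.cons_val_zero,
    Matrix.cons_val_one, mul_inv_eq_one]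
  exact ⟨fun ⟨h₁, h₂, h₃⟩ ↦ ⟨h₁, h₂, h₃⟩, fun h ↦ ⟨h.1, h.2, h.3⟩⟩

lemma lift_splitRels_iff {ℓ : ℕ} {k : ℤ} :
    (∀ r ∈ splitRels ℓ k, FreeGroup.lift ![a, b] r = 1) ↔ ExtensionRel (2 ^ ℓ) k 0 a b := by
  rw [← lift_extensionRels_iff]
  simp [splitRels, extensionRels]

lemma lift_quaternionRels_iff {ℓ : ℕ} :
    (∀ r ∈ quaternionRels ℓ, FreeGroup.lift ![a, b] r = 1) ↔
      ExtensionRel (2 ^ ℓ) (-1) (2 ^ (ℓ - 1)) a b := by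
  have hcast : a ^ ((2 : ℤ) ^ (ℓ - 1)) = a ^ 2 ^ (ℓ - 1) := by
    rw [← zpow_natCast]
    push_cast
    rfl
  rw [← lift_extensionRels_iff]
  simp only [quaternionRels, extensionRels, Set.mem_insert_iff, Set.mem_singleton_iff,
    forall_eq_or_imp, forall_eq, map_mul, map_pow, map_inv, map_zpow, FreeGroup.lift_apply_of,
    Matrix.cons_val_zero, Matrix.cons_val_one, mul_inv_eq_one, zpow_neg_one, inv_inv, hcast]
  rw [eq_comm (a := b ^ 2)]

/-- A group with the relations of a presentation, in which the order of `a` and the index of `⟨a⟩`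
have not collapsed, is presented by them: by the relations every element has the form `a ^ i` or
`a ^ i * b`, so that the group defined by the presentation cannot be larger. -/
lemma IsCyclicExtension.isPresentation {n : ℕ} {k e : ℤ} (h : IsCyclicExtension n k e a b)
    {rels : Set (FreeGroup (Fin 2))} (hG : ∀ r ∈ rels, FreeGroup.lift ![a, b] r = 1)
    (hrels : ExtensionRel n k e (PresentedGroup.of 0 : PresentedGroup rels)
      (PresentedGroup.of 1 : PresentedGroup rels)) : IsPresentation ![a, b] rels := by
  constructor
  · rw [← MonoidHom.range_eq_top, FreeGroup.range_lift_eq_closure, Matrix.range_cons,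
      Matrix.range_cons, Matrix.range_empty, Set.union_empty, Set.singleton_union, h.closure_eq]
  refine le_antisymm (fun w hw ↦ ?_) (Subgroup.normalClosure_le_normal hG)
  rw [← PresentedGroup.mk_eq_one_iff]
  have hcl : PresentedGroup.mk rels w ∈ Subgroup.closure
      {(PresentedGroup.of 0 : PresentedGroup rels), (PresentedGroup.of 1 : PresentedGroup rels)} := by
    have := PresentedGroup.closure_range_of rels
    rw [show Set.range (PresentedGroup.of : Fin 2 → PresentedGroup rels) =
      {PresentedGroup.of 0, PresentedGroup.of 1} by ext; simp [Fin.exists_fin_two, eq_comm]] at this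
    rw [this]
    trivial
  have hmap : PresentedGroup.toGroup hG (PresentedGroup.mk rels w) = 1 := hw
  obtain ⟨i, hi | hi⟩ := hrels.exists_zpow_of_mem_closure hcl
  · rw [hi] at hmap ⊢
    rw [map_zpow, PresentedGroup.toGroup.of, Matrix.cons_val_zero, h.zpow_eq_one_iff] at hmap
    rw [hrels.zpow_eq_zpow (j := 0) (by simpa using hmap), zpow_zero]
  · rw [hi, map_mul, map_zpow, PresentedGroup.toGroup.of, PresentedGroup.toGroup.of] at hmap
    exact (h.zpow_mul_ne_zpow i 0 (by simpa using hmap)).elim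

lemma presentedGroup_lift_eq_one {rels : Set (FreeGroup (Fin 2))} :
    ∀ r ∈ rels, FreeGroup.lift ![(PresentedGroup.of 0 : PresentedGroup rels),
      (PresentedGroup.of 1 : PresentedGroup rels)] r = 1 := by
  intro r hr
  have : FreeGroup.lift ![(PresentedGroup.of 0 : PresentedGroup rels),
      (PresentedGroup.of 1 : PresentedGroup rels)] = PresentedGroup.mk rels := by
    ext i
    fin_cases i <;> simp [PresentedGroup.of]
  rw [this]
  exact PresentedGroup.one_of_mem hr

lemma IsCyclicExtension.isPresentation_splitRels {ℓ : ℕ} {k : ℤ}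
    (h : IsCyclicExtension (2 ^ ℓ) k 0 a b) : IsPresentation ![a, b] (splitRels ℓ k) :=
  h.isPresentation (lift_splitRels_iff.2 h.toExtensionRel)
    (lift_splitRels_iff.1 presentedGroup_lift_eq_one)

lemma IsCyclicExtension.isPresentation_quaternionRels {ℓ : ℕ}
    (h : IsCyclicExtension (2 ^ ℓ) (-1) (2 ^ (ℓ - 1)) a b) :
    IsPresentation ![a, b] (quaternionRels ℓ) :=
  h.isPresentation (lift_quaternionRels_iff.2 h.toExtensionRel)
    (lift_quaternionRels_iff.1 presentedGroup_lift_eq_one)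

/-- The universal property of a cyclic extension. -/
lemma IsCyclicExtension.exists_hom {H : Type*} [Group H] {n : ℕ} {k e : ℤ}
    (h : IsCyclicExtension n k e a b) {a' b' : H} (h' : ExtensionRel n k e a' b') :
    ∃ f : G →* H, f a = a' ∧ f b = b' := by
  have hp := h.isPresentation (lift_extensionRels_iff.2 h.toExtensionRel)
    (lift_extensionRels_iff.1 presentedGroup_lift_eq_one)
  obtain ⟨f, hf⟩ := hp.exists_lift ![a', b'] (lift_extensionRels_iff.2 h')
  exact ⟨f, hf 0, hf 1⟩

lemma IsCyclicExtension.exists_mulEquiv {H : Type*} [Group H] {n : ℕ} {k e : ℤ}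
    (h : IsCyclicExtension n k e a b) {a' b' : H} (h' : IsCyclicExtension n k e a' b') :
    ∃ f : G ≃* H, f a = a' ∧ f b = b' := by
  obtain ⟨f, hfa, hfb⟩ := h.exists_hom h'.toExtensionRel
  obtain ⟨g, hga, hgb⟩ := h'.exists_hom h.toExtensionRel
  refine ⟨f.toMulEquiv g (h.hom_ext ?_ ?_) (h'.hom_ext ?_ ?_), hfa, hfb⟩ <;>
    simp [hfa, hfb, hga, hgb]

lemma IsCyclicExtension.exists_mulAut [Finite G] {n : ℕ} {k e : ℤ}
    (h : IsCyclicExtension n k e a b) {a' b' : G} (h' : ExtensionRel n k e a' b')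
    (hcl : Subgroup.closure {a', b'} = ⊤) : ∃ f : MulAut G, f a = a' ∧ f b = b' := by
  obtain ⟨f, hfa, hfb⟩ := h.exists_hom h'
  have hsurj : Function.Surjective f := by
    rw [← MonoidHom.range_eq_top, eq_top_iff, ← hcl, Subgroup.closure_le]
    rintro x (rfl | rfl)
    exacts [⟨a, hfa⟩, ⟨b, hfb⟩]
  exact ⟨MulEquiv.ofBijective f (Finite.injective_iff_bijective.1
    (Finite.injective_iff_surjective.2 hsurj)), hfa, hfb⟩

end

/-! ### Models of the presented groups -/

lemma exists_cycHom {H : Type*} [Group H] {n : ℕ} {g : H} (hg : g ^ n = 1) :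
    ∃ f : Cyc n →* H, ∀ i : ℤ, f (Multiplicative.ofAdd (i : ZMod n)) = g ^ i := by
  refine ⟨AddMonoidHom.toMultiplicativeLeft
    (ZMod.lift n ⟨zmultiplesHom (Additive H) (Additive.ofMul g), ?_⟩), fun i ↦ ?_⟩
  · simp [← ofMul_pow, hg]
  · simp

lemma cyc_exists_int {n : ℕ} (x : Cyc n) : ∃ i : ℤ, x = Multiplicative.ofAdd (i : ZMod n) :=
  ⟨(x.toAdd.cast : ℤ), by simp⟩

lemma orderOf_cyc_one (n : ℕ) : orderOf (Multiplicative.ofAdd (1 : ZMod n)) = n := by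
  rw [orderOf_ofAdd_eq_addOrderOf, ZMod.addOrderOf_one]

lemma cyc_one_pow (n : ℕ) : Multiplicative.ofAdd (1 : ZMod n) ^ n = 1 :=
  orderOf_dvd_iff_pow_eq_one.1 (orderOf_cyc_one n).dvd

lemma cycAutEquivUnits_symm_apply {n : ℕ} (u : (ZMod n)ˣ) (x : ZMod n) :
    (cycAutEquivUnits n).symm u (Multiplicative.ofAdd x) = Multiplicative.ofAdd (u * x) := rfl

/-- The relations do not collapse if they hold in a group where they have not collapsed. -/
lemma ExtensionRel.isCyclicExtension {G H : Type*} [Group G] [Group H] {n : ℕ} {k e : ℤ} {a b : G}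
    (h : ExtensionRel n k e a b) (hcl : Subgroup.closure {a, b} = ⊤) (f : G →* H)
    (ha : orderOf (f a) = n) (hb : f b ∉ Subgroup.zpowers (f a)) :
    IsCyclicExtension n k e a b where
  __ := h
  orderOf_eq := Nat.dvd_antisymm (orderOf_dvd_of_pow_eq_one h.pow_eq_one)
    (ha ▸ orderOf_map_dvd f a)
  notMem := by
    rintro ⟨i, rfl⟩
    exact hb ⟨i, (map_zpow f a i).symm⟩
  closure_eq := hcl

/-- The model of a split extension is the semidirect product of `Z_n` by `Z_2`, whose generator acts
by `x ↦ x ^ k`. -/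
lemma exists_split_model {n : ℕ} {k : ℤ} (hk : (n : ℤ) ∣ k * k - 1) :
    ∃ (H : Type) (_ : Group H) (a b : H), ExtensionRel n k 0 a b ∧ orderOf a = n ∧
      b ∉ Subgroup.zpowers a := by
  have hkk : (k : ZMod n) * k = 1 := by
    have := (ZMod.intCast_zmod_eq_zero_iff_dvd (k * k - 1) n).2 hk
    push_cast at this
    exact sub_eq_zero.1 this
  let u : (ZMod n)ˣ := ⟨k, k, hkk, hkk⟩
  have hu : u * u = 1 := Units.ext hkk
  obtain ⟨φ, hφ⟩ := exists_cycHom (n := 2) (g := (cycAutEquivUnits n).symm u)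
    (by rw [pow_two, ← map_mul, hu, map_one])
  let x : Cyc n := Multiplicative.ofAdd 1
  let y : Cyc 2 := Multiplicative.ofAdd 1
  have hy : y⁻¹ = y := rfl
  refine ⟨Cyc n ⋊[φ] Cyc 2, inferInstance, SemidirectProduct.inl x, SemidirectProduct.inr y,
    ⟨?_, ?_, ?_⟩, ?_, ?_⟩
  · rw [← map_pow, cyc_one_pow, map_one]
  · rw [← map_pow, cyc_one_pow, map_one, zpow_zero]
  · have := SemidirectProduct.inl_aut (φ := φ) y⁻¹ x
    rw [inv_inv, map_inv SemidirectProduct.inr] at this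
    rw [← this, ← map_zpow]
    congr 1
    have h1 := hφ 1
    rw [Int.cast_one, zpow_one] at h1
    rw [hy, h1, cycAutEquivUnits_symm_apply, ← ofAdd_zsmul]
    simp [u]
  · rw [orderOf_injective _ SemidirectProduct.inl_injective, orderOf_cyc_one]
  · rintro ⟨i, hi⟩
    have := congrArg SemidirectProduct.right hi
    simp only [← map_zpow, SemidirectProduct.right_inl, SemidirectProduct.right_inr] at this
    exact absurd this (by decide)

lemma DihedralGroup.isCyclicExtension (n : ℕ) :
    IsCyclicExtension n (-1) 0 (r 1 : DihedralGroup n) (sr 0) where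
  pow_eq_one := r_one_pow_n
  sq_eq := by simp [pow_two]
  conj_eq := by simp
  orderOf_eq := orderOf_r_one
  notMem := by
    rintro ⟨i, hi⟩
    simp at hi
  closure_eq := by
    rw [eq_top_iff]
    rintro (i | i) -
    · rw [← ZMod.intCast_zmod_cast i, ← r_one_zpow]
      exact zpow_mem (Subgroup.subset_closure (by simp)) _
    · rw [← ZMod.intCast_zmod_cast i, show sr ((i.cast : ℤ) : ZMod n) = sr 0 * r ((i.cast : ℤ) :
        ZMod n) by simp, ← r_one_zpow]
      exact mul_mem (Subgroup.subset_closure (by simp))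
        (zpow_mem (Subgroup.subset_closure (by simp)) _)

lemma QuaternionGroup.isCyclicExtension (n : ℕ) [NeZero n] :
    IsCyclicExtension (2 * n) (-1) n (a 1 : QuaternionGroup n) (xa 0) where
  pow_eq_one := a_one_pow_n
  sq_eq := by rw [xa_sq, zpow_natCast, a_one_pow]
  conj_eq := by
    rw [zpow_neg_one, mul_assoc, inv_mul_eq_iff_eq_mul, a_mul_xa, eq_mul_inv_iff_mul_eq, xa_mul_a]
    simp
  orderOf_eq := orderOf_a_one
  notMem := by
    rintro ⟨i, hi⟩
    obtain ⟨j, rfl | rfl⟩ := i.eq_nat_or_neg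
    · simp at hi
    · beta_reduce at hi
      rw [zpow_neg, zpow_natCast, a_one_pow, inv_eq_iff_eq_inv, eq_inv_iff_mul_eq_one, a_mul_xa,
        one_def] at hi
      exact nomatch hi
  closure_eq := by
    have ha (i : ZMod (2 * n)) : a i ∈ Subgroup.closure {(a 1 : QuaternionGroup n), xa 0} := by
      rw [← ZMod.natCast_zmod_val i, ← a_one_pow]
      exact pow_mem (Subgroup.subset_closure (by simp)) _
    rw [eq_top_iff]
    rintro (i | i) -
    · exact ha i
    · rw [show xa i = xa 0 * a i by simp]
      exact mul_mem (Subgroup.subset_closure (by simp)) (ha i)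

section

variable {G : Type*} [Group G] {ℓ : ℕ} {k : ℤ} {a b : G}

lemma IsPresentation.closure_pair {rels : Set (FreeGroup (Fin 2))}
    (h : IsPresentation ![a, b] rels) : Subgroup.closure {a, b} = ⊤ := by
  rw [← h.closure_range, Matrix.range_cons, Matrix.range_cons, Matrix.range_empty, Set.union_empty,
    Set.singleton_union]

lemma IsPresentation.isCyclicExtension_split (h : IsPresentation ![a, b] (splitRels ℓ k))
    (hk : 2 ^ ℓ ∣ k * k - 1) : IsCyclicExtension (2 ^ ℓ) k 0 a b := by
  obtain ⟨H, _, x, y, hxy, hx, hy⟩ := exists_split_model (n := 2 ^ ℓ) (by exact_mod_cast hk)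
  obtain ⟨f, hf⟩ := h.exists_lift ![x, y] (lift_splitRels_iff.2 hxy)
  have hfa : f a = x := hf 0
  have hfb : f b = y := hf 1
  exact (lift_splitRels_iff.1 fun r hr ↦ h.lift_eq_one hr).isCyclicExtension h.closure_pair f
    (hfa ▸ hx) (hfa ▸ hfb ▸ hy)

lemma IsPresentation.isCyclicExtension_quaternion (h : IsPresentation ![a, b] (quaternionRels ℓ))
    (hℓ : 1 ≤ ℓ) : IsCyclicExtension (2 ^ ℓ) (-1) (2 ^ (ℓ - 1)) a b := by
  have hq := QuaternionGroup.isCyclicExtension (2 ^ (ℓ - 1))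
  replace hq := hq.congr_order (m := 2 ^ ℓ) (by rw [← pow_succ', Nat.sub_add_cancel hℓ])
  rw [Nat.cast_pow, Nat.cast_two] at hq
  obtain ⟨f, hf⟩ := h.exists_lift ![QuaternionGroup.a 1, QuaternionGroup.xa 0]
    (lift_quaternionRels_iff.2 hq.toExtensionRel)
  have hfa : f a = .a 1 := hf 0
  have hfb : f b = .xa 0 := hf 1
  exact (lift_quaternionRels_iff.1 fun r hr ↦ h.lift_eq_one hr).isCyclicExtension h.closure_pair f
    (hfa ▸ hq.orderOf_eq) (hfa ▸ hfb ▸ hq.notMem)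

lemma IsPresentation.orderOf_cyclic (h : IsPresentation ![a] (cyclicRels ℓ)) :
    orderOf a = 2 ^ ℓ ∧ Subgroup.zpowers a = ⊤ := by
  obtain ⟨f, hf⟩ := h.exists_lift ![(Multiplicative.ofAdd 1 : Cyc (2 ^ ℓ))]
    (by simpa only [cyclicRels, Set.mem_singleton_iff, forall_eq, map_pow, FreeGroup.lift_apply_of,
      Matrix.cons_val_zero] using cyc_one_pow _)
  have hfa : f a = Multiplicative.ofAdd 1 := hf 0
  refine ⟨Nat.dvd_antisymm (orderOf_dvd_of_pow_eq_one ?_) ?_, ?_⟩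
  · simpa only [map_pow, FreeGroup.lift_apply_of, Matrix.cons_val_zero] using
      h.lift_eq_one (Set.mem_singleton (FreeGroup.of 0 ^ 2 ^ ℓ))
  · rw [← orderOf_cyc_one (2 ^ ℓ), ← hfa]
    exact orderOf_map_dvd f a
  · rw [← h.closure_range, Matrix.range_cons, Matrix.range_empty, Set.union_empty,
      Subgroup.zpowers_eq_closure]

lemma isPresentation_cyclicRels (ha : orderOf a = 2 ^ ℓ) (hcl : Subgroup.zpowers a = ⊤) :
    IsPresentation ![a] (cyclicRels ℓ) := by
  constructor
  · rw [← MonoidHom.range_eq_top, FreeGroup.range_lift_eq_closure, Matrix.range_cons,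
      Matrix.range_empty, Set.union_empty, ← Subgroup.zpowers_eq_closure, hcl]
  refine le_antisymm (fun w hw ↦ ?_) (Subgroup.normalClosure_le_normal ?_)
  · have hw' : w ∈ Subgroup.closure {(FreeGroup.of 0 : FreeGroup (Fin 1))} := by
      have := FreeGroup.closure_range_of (Fin 1)
      rw [Set.range_unique] at this
      simpa using this ▸ Subgroup.mem_top w
    obtain ⟨i, rfl⟩ := Subgroup.mem_closure_singleton.1 hw'
    have hi : a ^ i = 1 := by simpa using hw
    rw [← orderOf_dvd_iff_zpow_eq_one, ha] at hi
    obtain ⟨t, rfl⟩ := hi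
    rw [zpow_mul, zpow_natCast]
    exact zpow_mem (Subgroup.subset_normalClosure (Set.mem_singleton _)) _
  · rw [cyclicRels, Set.singleton_subset_iff, SetLike.mem_coe, MonoidHom.mem_ker, map_pow,
      FreeGroup.lift_apply_of, Matrix.cons_val_zero, ← ha, pow_orderOf_eq_one]

end

/-! ### Units modulo a power of two -/

/-- The unit group modulo `2 ^ (m + 2)` is `⟨5⟩ × ⟨-1⟩`: the powers of `5` are `1` modulo `4`, and
they form a subgroup of index `2`. -/
lemma ZMod.exists_unit_five (m : ℕ) : ∃ v : (ZMod (2 ^ (m + 2)))ˣ, (v : ZMod (2 ^ (m + 2))) = 5 ∧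
    orderOf v = 2 ^ m ∧ (∀ i : ℤ, v ^ i ≠ -1) ∧ ∀ u, ∃ i : ℤ, u = v ^ i ∨ u = -1 * v ^ i := by
  have h5 : IsUnit (5 : ZMod (2 ^ (m + 2))) := by
    have := (ZMod.isUnit_iff_coprime 5 (2 ^ (m + 2))).2 (Nat.Coprime.pow_right _ (by decide))
    exact_mod_cast this
  obtain ⟨v, hv⟩ := h5
  have ho : orderOf v = 2 ^ m := by rw [← orderOf_units, hv, ZMod.orderOf_five]
  have hne (i : ℤ) : v ^ i ≠ -1 := by
    intro h
    have hd : 4 ∣ 2 ^ (m + 2) := ⟨2 ^ m, by ring⟩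
    have hv1 : ZMod.unitsMap hd v = 1 := by
      ext
      change ZMod.castHom hd (ZMod 4) v = 1
      rw [hv, map_ofNat]
      decide
    have := congrArg (ZMod.unitsMap hd) h
    rw [map_zpow, hv1, one_zpow] at this
    have h2 : ZMod.unitsMap hd (-1) = -1 := by
      ext
      simp [ZMod.unitsMap_val, ZMod.cast_neg hd, ZMod.cast_one hd]
    rw [h2] at this
    exact absurd this (by decide)
  have hidx : (Subgroup.zpowers v).index = 2 := by
    have h1 := (Subgroup.zpowers v).card_mul_index
    rw [Nat.card_zpowers, ho, Nat.card_eq_fintype_card, ZMod.card_units_eq_totient,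
      Nat.totient_prime_pow_succ Nat.prime_two] at h1
    have h2 : 2 ^ m * (Subgroup.zpowers v).index = 2 ^ m * 2 := by rw [h1]; ring
    exact Nat.eq_of_mul_eq_mul_left (by positivity) h2
  refine ⟨v, hv, ho, hne, fun u ↦ ?_⟩
  by_cases hu : u ∈ Subgroup.zpowers v
  · obtain ⟨i, rfl⟩ := hu
    exact ⟨i, .inl rfl⟩
  · have h1 : -1 ∉ Subgroup.zpowers v := fun ⟨i, hi⟩ ↦ hne i hi
    obtain ⟨i, hi⟩ := (Subgroup.mul_mem_iff_of_index_two hidx (a := -1) (b := u)).2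
      ⟨fun h ↦ (h1 h).elim, fun h ↦ (hu h).elim⟩
    refine ⟨i, .inr ?_⟩
    simp only at hi
    rw [hi]
    simp

/-! ### Automorphisms of a cyclic extension -/

namespace IsCyclicExtension

variable {G : Type*} [Group G] {n : ℕ} {k e : ℤ} {a b : G}

lemma isUnit_of_apply [Finite G] (h : IsCyclicExtension n k e a b) {f : MulAut G} {i : ℤ}
    (hf : f a = a ^ i) : IsUnit (i : ZMod n) := by
  rw [ZMod.coe_int_isUnit_iff_isCoprime, Int.isCoprime_iff_gcd_eq_one, Int.gcd_comm,
    ← h.orderOf_eq, ← mem_zpowers_zpow_iff]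
  have hle : Subgroup.zpowers (a ^ i) ≤ Subgroup.zpowers a := by simp
  rw [Subgroup.eq_of_le_of_card_ge hle]
  · exact Subgroup.mem_zpowers a
  · rw [Nat.card_zpowers, Nat.card_zpowers, ← hf, MulEquiv.orderOf_eq]

/-- The automorphisms `ρ_x : a ↦ a ^ x, b ↦ b` form a homomorphic image of the units modulo `n`. -/
lemma exists_powHom [Finite G] (h : IsCyclicExtension n k e a b) (hn : Even n)
    (he : (n : ℤ) ∣ 2 * e) : ∃ ρ : (ZMod n)ˣ →* MulAut G,
      ∀ (u : (ZMod n)ˣ) (i : ℤ), (u : ZMod n) = i → ρ u a = a ^ i ∧ ρ u b = b := by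
  have key (u : (ZMod n)ˣ) : ∃ f : MulAut G, f a = a ^ ((u : ZMod n).cast : ℤ) ∧ f b = b := by
    set i : ℤ := (u : ZMod n).cast with hi
    set j : ℤ := ((u⁻¹ : (ZMod n)ˣ) : ZMod n).cast with hj
    have hij : (n : ℤ) ∣ i * j - 1 := by
      rw [← ZMod.intCast_zmod_eq_zero_iff_dvd]
      simp [hi, hj]
    have hodd : Odd i := by
      have h2 : (2 : ℤ) ∣ i * j - 1 := dvd_trans (by exact_mod_cast hn.two_dvd) hij
      have h3 : Odd (i * j) := by
        rw [← Int.not_even_iff_odd, even_iff_two_dvd]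
        omega
      exact (Int.odd_mul.1 h3).1
    refine h.exists_mulAut ⟨?_, ?_, ?_⟩ ?_
    · rw [← zpow_natCast, zpow_comm, zpow_natCast, h.pow_eq_one, one_zpow]
    · rw [h.sq_eq, ← zpow_mul]
      obtain ⟨t, ht⟩ := hodd
      refine h.zpow_eq_zpow ?_
      rw [ht, show e - (2 * t + 1) * e = 2 * e * -t by ring]
      exact he.mul_right _
    · rw [h.conj_zpow, mul_comm, zpow_mul]
    · have ha : (a ^ i) ^ j = a := by
        rw [← zpow_mul, h.zpow_eq_zpow hij, zpow_one]
      rw [eq_top_iff, ← h.closure_eq, Subgroup.closure_le]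
      rintro x (rfl | rfl)
      · rw [← ha]
        exact zpow_mem (Subgroup.subset_closure (by simp [ha])) j
      · exact Subgroup.subset_closure (by simp)
  choose f hfa hfb using key
  have hf (u : (ZMod n)ˣ) (i : ℤ) (hi : (u : ZMod n) = i) : f u a = a ^ i := by
    rw [hfa, h.zpow_eq_zpow_iff, ← ZMod.intCast_zmod_eq_zero_iff_dvd]
    simp [hi]
  refine ⟨MonoidHom.mk' f fun u v ↦ h.mulAut_ext ?_ ?_, fun u i hi ↦ ⟨hf u i hi, hfb u⟩⟩
  · rw [MulAut.mul_apply, hfa v, map_zpow, hfa u, ← zpow_mul]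
    exact hf _ _ (by simp)
  · rw [MulAut.mul_apply, hfb, hfb, hfb]

lemma exists_shift [Finite G] (h : IsCyclicExtension n k e a b) {s : ℤ}
    (hs : (n : ℤ) ∣ s * (1 + k)) : ∃ η : MulAut G, η a = a ∧ η b = a ^ s * b := by
  refine h.exists_mulAut ⟨h.pow_eq_one, ?_, ?_⟩ ?_
  · rw [h.zpow_mul_sq]
    exact h.zpow_eq_zpow (by simpa using hs)
  · rw [← h.conj_eq]
    group
  · rw [eq_top_iff, ← h.closure_eq, Subgroup.closure_le]
    rintro x (rfl | rfl)
    · exact Subgroup.subset_closure (by simp)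
    · rename_i hx
      have := mul_mem (inv_mem (zpow_mem (Subgroup.subset_closure (Set.mem_insert a {a ^ s * x})) s))
        (Subgroup.subset_closure (Set.mem_insert_of_mem a (Set.mem_singleton (a ^ s * x))))
      rwa [inv_mul_cancel_left] at this

end IsCyclicExtension

lemma MulAut.zpow_apply_shift {G : Type*} [Group G] {a b : G} {s : ℤ} {η : MulAut G} (ha : η a = a)
    (hb : η b = a ^ s * b) (i : ℤ) : (η ^ i) a = a ∧ (η ^ i) b = a ^ (s * i) * b := by
  induction i with
  | zero => simp
  | succ i ih =>
    rw [zpow_add_one, MulAut.mul_apply, MulAut.mul_apply, ha, hb, map_mul, map_zpow, ih.1, ih.2,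
      mul_add, zpow_add, mul_one, ← mul_assoc, (Commute.zpow_zpow_self a _ _).eq]
    exact ⟨rfl, rfl⟩
  | pred i ih =>
    have hb' : η⁻¹ b = a ^ (-s) * b := by
      refine (MulEquiv.symm_apply_eq η).2 ?_
      rw [map_mul, map_zpow, ha, hb]
      group
    have ha' : η⁻¹ a = a := (MulEquiv.symm_apply_eq η).2 ha.symm
    rw [zpow_sub_one, MulAut.mul_apply, MulAut.mul_apply, ha', hb', map_mul, map_zpow, ih.1, ih.2,
      ← mul_assoc, ← zpow_add]
    refine ⟨rfl, ?_⟩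
    congr 2
    ring

/-- Recognition of the semidirect product of `Z_m` by `Aut(Z_n)`. -/
lemma nonempty_mulEquiv_semidirectProduct {A : Type*} [Group A] {m n : ℕ} (hmn : m ∣ n)
    (ρ : (ZMod n)ˣ →* A) (η : A) (hη : orderOf η = m)
    (hρ : ∀ (u : (ZMod n)ˣ) (i : ℤ), η ^ i * ρ u = 1 → u = 1)
    (hconj : ∀ (u : (ZMod n)ˣ) (i : ℤ), (u : ZMod n) = i → ρ u * η * (ρ u)⁻¹ = η ^ i)
    (hgen : ∀ x, ∃ (i : ℤ) (u : (ZMod n)ˣ), x = η ^ i * ρ u) :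
    Nonempty (A ≃* Cyc m ⋊[cycAutAction hmn] MulAut (Cyc n)) := by
  obtain ⟨f, hf⟩ := exists_cycHom (n := m) (g := η) (hη ▸ pow_orderOf_eq_one η)
  let F : Cyc m ⋊[cycAutAction hmn] MulAut (Cyc n) →* A :=
    SemidirectProduct.lift f (ρ.comp (cycAutEquivUnits n).toMonoidHom) fun g ↦ by
      refine MonoidHom.ext fun x ↦ ?_
      obtain ⟨i, rfl⟩ := cyc_exists_int x
      obtain ⟨u, rfl⟩ := (cycAutEquivUnits n).symm.surjective g
      have hu : cycAutAction hmn ((cycAutEquivUnits n).symm u) (Multiplicative.ofAdd (i : ZMod m)) =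
          Multiplicative.ofAdd ((((u : ZMod n).cast * i : ℤ)) : ZMod m) := by
        simp only [cycAutAction, MonoidHom.comp_apply, MulEquiv.coe_toMonoidHom,
          MulEquiv.apply_symm_apply, cycAutEquivUnits_symm_apply, ZMod.unitsMap_val]
        push_cast
        simp
      simp only [MonoidHom.comp_apply, MulEquiv.coe_toMonoidHom, MulEquiv.apply_symm_apply,
        MulAut.conj_apply]
      rw [hu, hf, hf, zpow_mul, ← hconj u _ (by simp), conj_zpow]
  have hF (i : ℤ) (u : (ZMod n)ˣ) : F (SemidirectProduct.inl (Multiplicative.ofAdd (i : ZMod m)) *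
      SemidirectProduct.inr ((cycAutEquivUnits n).symm u)) = η ^ i * ρ u := by
    simp [F, hf]
  refine ⟨(MulEquiv.ofBijective F ⟨?_, fun x ↦ ?_⟩).symm⟩
  · rw [injective_iff_map_eq_one]
    intro x hx
    obtain ⟨i, hi⟩ := cyc_exists_int x.left
    obtain ⟨u, hu⟩ := (cycAutEquivUnits n).symm.surjective x.right
    rw [← SemidirectProduct.inl_left_mul_inr_right x, hi, ← hu] at hx ⊢
    rw [hF] at hx
    obtain rfl := hρ u i hx
    rw [map_one, mul_one, ← orderOf_dvd_iff_zpow_eq_one, hη] at hx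
    rw [(ZMod.intCast_zmod_eq_zero_iff_dvd i m).2 hx]
    simp
  · obtain ⟨i, u, rfl⟩ := hgen x
    exact ⟨_, hF i u⟩

lemma cycAutAction_dvd_refl (n : ℕ) : cycAutAction (dvd_refl n) = MonoidHom.id (MulAut (Cyc n)) := by
  ext1 f
  simp [cycAutAction]

/-- If every automorphism preserves `⟨a⟩` and sends `b` into `⟨a ^ s⟩ b`, then the automorphism group
is the semidirect product of `⟨η⟩`, where `η : a ↦ a, b ↦ a ^ s * b`, by the group of all
`ρ_x : a ↦ a ^ x, b ↦ b`, and `ρ_x` raises `η` to the power `x`. -/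
lemma IsCyclicExtension.mulAut_semidirect {G : Type*} [Group G] [Finite G] {ℓ m s : ℕ} {k e : ℤ}
    {a b : G} (h : IsCyclicExtension (2 ^ ℓ) k e a b) (hℓ : 2 ≤ ℓ) (hm : m ∣ 2 ^ ℓ)
    (hms : s * m = 2 ^ ℓ) (hs : 2 ^ ℓ ∣ s * (1 + k)) (he : 2 ^ ℓ ∣ 2 * e)
    (hchar : ∀ f : MulAut G, (∃ i : ℤ, f a = a ^ i) ∧ ∃ j : ℤ, f b = a ^ (s * j) * b) :
    (∃ ρ₅ ρneg η : MulAut G, (ρ₅ a = a ^ 5 ∧ ρ₅ b = b) ∧ (ρneg a = a⁻¹ ∧ ρneg b = b) ∧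
      (η a = a ∧ η b = a ^ s * b) ∧ Subgroup.closure {ρ₅, ρneg, η} = ⊤) ∧
    Nonempty (MulAut G ≃* Cyc m ⋊[cycAutAction hm] MulAut (Cyc (2 ^ ℓ))) := by
  have h2 : Even (2 ^ ℓ) := by rw [Nat.even_pow]; exact ⟨even_two, by omega⟩
  obtain ⟨ρ, hρ⟩ := h.exists_powHom h2 (by exact_mod_cast he)
  obtain ⟨η, hηa, hηb⟩ := h.exists_shift (by exact_mod_cast hs)
  have hη := MulAut.zpow_apply_shift hηa hηb
  have hone (i : ℤ) : η ^ i = 1 ↔ (m : ℤ) ∣ i := by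
    have hs0 : (s : ℤ) ≠ 0 := by
      rintro h0
      rw [Nat.cast_eq_zero.1 h0, zero_mul] at hms
      exact absurd hms.symm (by positivity)
    rw [← mul_dvd_mul_iff_left hs0, ← Nat.cast_mul, hms, ← h.zpow_eq_one_iff]
    refine ⟨fun hi ↦ ?_, fun hi ↦ h.mulAut_ext (hη i).1 ?_⟩
    · have := (hη i).2
      rwa [hi, MulAut.one_apply, right_eq_mul] at this
    · rw [(hη i).2, hi, one_mul, MulAut.one_apply]
  have hord : orderOf η = m := by
    refine Nat.dvd_antisymm (orderOf_dvd_of_pow_eq_one ?_) ?_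
    · rw [← zpow_natCast, hone]
    · have := (hone (orderOf η)).1 (by rw [zpow_natCast, pow_orderOf_eq_one])
      exact_mod_cast this
  have hgen (x : MulAut G) : ∃ (i : ℤ) (u : (ZMod (2 ^ ℓ))ˣ), x = η ^ i * ρ u := by
    obtain ⟨⟨i, hi⟩, j, hj⟩ := hchar x
    obtain ⟨u, hu⟩ := h.isUnit_of_apply hi
    refine ⟨j, u, h.mulAut_ext ?_ ?_⟩
    · rw [MulAut.mul_apply, (hρ u i hu).1, map_zpow, (hη j).1, hi]
    · rw [MulAut.mul_apply, (hρ u i hu).2, (hη j).2, hj]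
  constructor
  · obtain ⟨m', rfl⟩ := Nat.exists_eq_add_of_le' hℓ
    obtain ⟨v, hv, -, -, hv'⟩ := ZMod.exists_unit_five m'
    have h5 := hρ v 5 (by simpa using hv)
    have h1 := hρ (-1) (-1) (by simp)
    refine ⟨ρ v, ρ (-1), η, ⟨by exact_mod_cast h5.1, h5.2⟩, ⟨by simpa using h1.1, h1.2⟩,
      ⟨hηa, by exact_mod_cast hηb⟩, ?_⟩
    rw [eq_top_iff]
    rintro x -
    obtain ⟨i, u, rfl⟩ := hgen x
    refine mul_mem (zpow_mem (Subgroup.subset_closure (by simp)) _) ?_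
    obtain ⟨j, rfl | rfl⟩ := hv' u
    · rw [map_zpow]
      exact zpow_mem (Subgroup.subset_closure (by simp)) _
    · rw [map_mul, map_zpow]
      exact mul_mem (Subgroup.subset_closure (by simp))
        (zpow_mem (Subgroup.subset_closure (by simp)) _)
  · refine nonempty_mulEquiv_semidirectProduct hm ρ η hord (fun u i hu ↦ ?_) (fun u i hi ↦ ?_) hgen
    · obtain ⟨j, hj⟩ := ZMod.intCast_surjective (u : ZMod (2 ^ ℓ))
      have := DFunLike.congr_fun hu a
      rw [MulAut.mul_apply, (hρ u j hj.symm).1, map_zpow, (hη i).1, MulAut.one_apply] at this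
      have h1 := h.zpow_eq_zpow_iff.1 (this.trans (zpow_one a).symm)
      rw [← ZMod.intCast_zmod_eq_zero_iff_dvd] at h1
      ext
      rw [← hj, Units.val_one, ← sub_eq_zero, ← h1]
      simp
    · have hu := hρ u i hi
      rw [mul_inv_eq_iff_eq_mul]
      refine h.mulAut_ext ?_ ?_
      · rw [MulAut.mul_apply, MulAut.mul_apply, hηa, hu.1, map_zpow, (hη i).1]
      · rw [MulAut.mul_apply, MulAut.mul_apply, hηb, hu.2, map_mul, map_zpow, hu.1, hu.2, (hη i).2,
          ← zpow_mul, mul_comm i]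

/-! ### Recognition of `(Z_{2 ^ (m + 1)} ∘ D_8) × Z_2` -/

lemma DihedralGroup.center_four :
    Subgroup.center (DihedralGroup 4) = Subgroup.zpowers (r 2) := by
  have h : ∀ x : DihedralGroup 4, (∀ g, g * x = x * g) ↔ x = 1 ∨ x = r 2 := by decide
  ext x
  rw [Subgroup.mem_center_iff, h]
  constructor
  · rintro (rfl | rfl)
    · exact one_mem _
    · exact Subgroup.mem_zpowers _
  · rintro ⟨i, rfl⟩
    have h2 : (r 2 : DihedralGroup 4) ^ (2 : ℤ) = 1 := by decide
    obtain ⟨j, rfl | rfl⟩ := Int.even_or_odd' i <;> simp [zpow_add, zpow_mul, h2]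

/-- The amalgam of the subgroups of order `2` of `Z_{2 ^ (m + 1)}` and of `D_8`. -/
lemma exists_centralAmalgam (m : ℕ) :
    ∃ D : CentralAmalgam (Cyc (2 ^ (m + 1))) (DihedralGroup 4),
      D.C₂ = Subgroup.center (DihedralGroup 4) ∧
      D.graph = Subgroup.zpowers
        (Multiplicative.ofAdd ((2 ^ m : ℤ) : ZMod (2 ^ (m + 1))), DihedralGroup.r 2) := by
  obtain ⟨z, hz⟩ : ∃ z : Cyc (2 ^ (m + 1)),
      z = Multiplicative.ofAdd ((2 ^ m : ℤ) : ZMod (2 ^ (m + 1))) := ⟨_, rfl⟩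
  rw [← hz]
  have hz1 : orderOf z = 2 := by
    refine orderOf_eq_prime ?_ ?_
    · rw [hz, ← ofAdd_nsmul, ofAdd_eq_one, nsmul_eq_mul]
      have := ZMod.natCast_self (2 ^ (m + 1))
      push_cast at this ⊢
      rwa [← pow_succ']
    · rw [hz, Ne, ofAdd_eq_one, ZMod.intCast_zmod_eq_zero_iff_dvd]
      push_cast
      rw [pow_succ]
      intro h
      have := Int.le_of_dvd (by positivity) h
      have : (0 : ℤ) < 2 ^ m := by positivity
      omega
  have hr : orderOf (DihedralGroup.r 2 : DihedralGroup 4) = 2 :=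
    orderOf_eq_prime (by decide) (by decide)
  have h1 : Nat.card (Subgroup.zpowers z) = 2 := by rw [Nat.card_zpowers, hz1]
  have h2 : Nat.card (Subgroup.center (DihedralGroup 4)) = 2 := by
    rw [DihedralGroup.center_four, Nat.card_zpowers, hr]
  let φ : Subgroup.zpowers z ≃* Subgroup.center (DihedralGroup 4) := mulEquivOfPrimeCardEq h1 h2
  have hφ : (φ ⟨z, Subgroup.mem_zpowers z⟩ : DihedralGroup 4) = DihedralGroup.r 2 := by
    have hne : (φ ⟨z, Subgroup.mem_zpowers z⟩ : DihedralGroup 4) ≠ 1 := by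
      rw [Ne, OneMemClass.coe_eq_one, map_eq_one_iff φ φ.injective, Subgroup.mk_eq_one]
      rintro h
      rw [h, orderOf_one] at hz1
      omega
    obtain ⟨i, hi⟩ := DihedralGroup.center_four.le (φ ⟨z, Subgroup.mem_zpowers z⟩).2
    beta_reduce at hi
    have h2 : (DihedralGroup.r 2 : DihedralGroup 4) ^ (2 : ℤ) = 1 := by decide
    rw [← hi] at hne ⊢
    obtain ⟨j, rfl | rfl⟩ := Int.even_or_odd' i
    · simp [zpow_mul, h2] at hne
    · simp [zpow_add, zpow_mul, h2]
  refine ⟨⟨Subgroup.zpowers z, Subgroup.center _, ?_, le_rfl, φ⟩, rfl, ?_⟩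
  · rw [CommGroup.center_eq_top]
    exact le_top
  · refine le_antisymm ?_ ?_
    · rintro _ ⟨⟨x, hx⟩, rfl⟩
      obtain ⟨i, hi⟩ := Subgroup.mem_zpowers_iff.1 hx
      have hx' : (⟨x, hx⟩ : Subgroup.zpowers z) = ⟨z, Subgroup.mem_zpowers z⟩ ^ i :=
        Subtype.ext hi.symm
      rw [hx']
      refine ⟨i, Prod.ext rfl ?_⟩
      simp [hφ]
    · rw [Subgroup.zpowers_le]
      exact ⟨⟨z, Subgroup.mem_zpowers z⟩, Prod.ext rfl hφ⟩

lemma zpow_eq_one_of_two_dvd {X : Type*} [Group X] {x : X} (hx : x ^ 2 = 1) {i : ℤ} (hi : 2 ∣ i) :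
    x ^ i = 1 := by
  obtain ⟨j, rfl⟩ := hi
  rw [zpow_mul, zpow_ofNat, hx, one_zpow]

/-- Here `⟨s, t⟩` is the factor `D_8`, with centre generated by `(s * t) ^ 2 = p ^ 2 ^ m`. The group
is an extension of `⟨(s * t) ^ 2⟩` by an abelian group, and `hind` is the independence of the
generators in that quotient. -/
lemma isCycCentralD8TimesZ2_of_generators {X : Type*} [Group X] {m : ℕ} {p s t c : X}
    (hp : orderOf p = 2 ^ (m + 1)) (hs : s ^ 2 = 1) (ht : t ^ 2 = 1) (hc : c ^ 2 = 1)
    (hst : (s * t) ^ 2 = p ^ 2 ^ m) (hps : Commute p s) (hpt : Commute p t) (hpc : Commute p c)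
    (hsc : Commute s c) (htc : Commute t c) (hgen : Subgroup.closure {p, s, t, c} = ⊤)
    (hind : ∀ x i j y : ℤ, p ^ x * s ^ i * t ^ j * c ^ y = 1 → 2 ∣ i ∧ 2 ∣ j ∧ 2 ∣ y) :
    IsCycCentralD8TimesZ2 (m + 3) X := by
  obtain ⟨D, hD, hgraph⟩ := exists_centralAmalgam m
  refine ⟨D, hD, ?_⟩
  have hp' : p ^ 2 ^ (m + 1) = 1 := hp ▸ pow_orderOf_eq_one p
  obtain ⟨P, hP⟩ := exists_cycHom hp'
  obtain ⟨C, hC⟩ := exists_cycHom hc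
  have hss : s * s = 1 := by rw [← pow_two, hs]
  have htt : t * t = 1 := by rw [← pow_two, ht]
  obtain ⟨δ, hδr, hδs⟩ := (DihedralGroup.isCyclicExtension 4).exists_hom (a' := s * t) (b' := s)
    ⟨by rw [show 4 = 2 * 2 from rfl, pow_mul, hst, ← pow_mul, ← pow_succ, hp'], by simpa using hs,
      by rw [inv_mul_cancel_left, zpow_neg_one, mul_inv_rev, inv_eq_of_mul_eq_one_left hss,
        inv_eq_of_mul_eq_one_left htt]⟩
  have hδ (d : DihedralGroup 4) : ∃ i j w : ℤ, δ d = p ^ (2 ^ m * w) * s ^ i * t ^ j ∧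
      (2 ∣ i → 2 ∣ j → d = DihedralGroup.r 2 ^ w) := by
    have hall : ∀ d : DihedralGroup 4, ∃ i j w : Fin 2, d = .r 2 ^ (w : ℕ) * .sr 0 ^ (i : ℕ) *
        (.sr 0 * .r 1) ^ (j : ℕ) := by decide
    obtain ⟨i, j, w, hd⟩ := hall d
    refine ⟨i, j, w, ?_, fun hi hj ↦ ?_⟩
    · rw [hd, map_mul, map_mul, map_pow, map_pow, map_pow, map_mul, hδr, hδs, ← mul_assoc, hss,
        one_mul, show (DihedralGroup.r 2 : DihedralGroup 4) = DihedralGroup.r 1 ^ 2 by decide,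
        map_pow, hδr, hst, zpow_natCast, zpow_natCast, zpow_mul, zpow_natCast, ← zpow_natCast p]
      push_cast
      rfl
    · rw [hd, show (i : ℕ) = 0 by omega, show (j : ℕ) = 0 by omega, pow_zero, pow_zero, mul_one,
        mul_one, zpow_natCast]
  have hPδ (x) (d) : Commute (P x) (δ d) := by
    obtain ⟨x, rfl⟩ := cyc_exists_int x
    obtain ⟨i, j, w, hd, -⟩ := hδ d
    rw [hP, hd]
    exact (((Commute.refl p).zpow_zpow _ _).mul_right (hps.zpow_zpow _ _)).mul_right
      (hpt.zpow_zpow _ _)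
  let q := P.noncommCoprod δ hPδ
  have hq : D.graph ≤ q.ker := by
    rw [hgraph, Subgroup.zpowers_le, MonoidHom.mem_ker, MonoidHom.noncommCoprod_apply, hP,
      show (DihedralGroup.r 2 : DihedralGroup 4) = DihedralGroup.r 1 ^ 2 by decide, map_pow, hδr,
      hst, ← zpow_natCast, ← zpow_add]
    push_cast
    rw [← mul_two, ← pow_succ]
    exact_mod_cast hp'
  have hqC (x) (y) : Commute (QuotientGroup.lift D.graph q hq x) (C y) := by
    obtain ⟨⟨x, d⟩, rfl⟩ := QuotientGroup.mk_surjective x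
    obtain ⟨y, rfl⟩ := cyc_exists_int y
    obtain ⟨x, rfl⟩ := cyc_exists_int x
    obtain ⟨i, j, w, hd, -⟩ := hδ d
    rw [QuotientGroup.lift_mk, MonoidHom.noncommCoprod_apply, hP, hC, hd]
    exact (hpc.zpow_zpow _ _).mul_left ((((hpc.zpow_zpow _ _).mul_left
      (hsc.zpow_zpow _ _))).mul_left (htc.zpow_zpow _ _))
  let F := (QuotientGroup.lift D.graph q hq).noncommCoprod C hqC
  have hF (x : ℤ) (d) (y : ℤ) : F (((Multiplicative.ofAdd (x : ZMod (2 ^ (m + 1))), d) :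
      Cyc (2 ^ (m + 1)) × DihedralGroup 4), Multiplicative.ofAdd (y : ZMod 2)) =
      p ^ x * δ d * c ^ y := by
    rw [MonoidHom.noncommCoprod_apply, QuotientGroup.lift_mk, MonoidHom.noncommCoprod_apply, hP, hC]
  refine ⟨(MulEquiv.ofBijective F ⟨?_, ?_⟩).symm⟩
  · rw [injective_iff_map_eq_one]
    rintro ⟨x, y⟩ hxy
    obtain ⟨⟨x, d⟩, rfl⟩ := QuotientGroup.mk_surjective x
    obtain ⟨y, rfl⟩ := cyc_exists_int y
    obtain ⟨x, rfl⟩ := cyc_exists_int x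
    rw [hF] at hxy
    obtain ⟨i, j, w, hd, hw⟩ := hδ d
    rw [hd, ← mul_assoc, ← mul_assoc, ← zpow_add] at hxy
    obtain ⟨hi, hj, hy⟩ := hind _ _ _ _ hxy
    rw [zpow_eq_one_of_two_dvd hs hi, zpow_eq_one_of_two_dvd ht hj, zpow_eq_one_of_two_dvd hc hy,
      mul_one, mul_one, mul_one, ← orderOf_dvd_iff_zpow_eq_one, hp] at hxy
    rw [hw hi hj, (ZMod.intCast_zmod_eq_zero_iff_dvd y 2).2 hy, ofAdd_zero, Prod.mk_eq_one]
    refine ⟨(QuotientGroup.eq_one_iff _).2 ?_, rfl⟩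
    rw [hgraph]
    refine ⟨w, Prod.ext ?_ rfl⟩
    -- `x` and `2 ^ m * w` agree, since `2 ^ m` is its own negative modulo `2 ^ (m + 1)`
    change Multiplicative.ofAdd ((2 ^ m : ℤ) : ZMod (2 ^ (m + 1))) ^ w = _
    rw [← ofAdd_zsmul, zsmul_eq_mul, ← Int.cast_mul]
    congr 1
    rw [← sub_eq_zero, ← Int.cast_sub, ZMod.intCast_zmod_eq_zero_iff_dvd]
    obtain ⟨y, hy⟩ := hxy
    refine ⟨w - y, ?_⟩
    rw [mul_sub, ← hy]
    push_cast
    ring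
  · rw [← MonoidHom.range_eq_top, eq_top_iff, ← hgen, Subgroup.closure_le]
    have hr (i : ℤ) (d) (y : ℤ) : p ^ i * δ d * c ^ y ∈ F.range := ⟨_, hF i d y⟩
    rintro x (hx | hx | hx | hx) <;> rw [hx]
    · simpa using hr 1 1 0
    · simpa [hδs] using hr 0 (.sr 0) 0
    · have := hr 0 (.sr 0 * .r 1) 0
      rw [map_mul, hδs, hδr, ← mul_assoc s, hss] at this
      simpa using this
    · simpa using hr 0 1 1

/-! ### Automorphism groups of the dihedral, semidihedral and quaternion groups -/

section

variable {G : Type*} [Group G] {n ℓ : ℕ} {k e : ℤ} {a b : G}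

/-- If the elements outside `⟨a⟩` have order dividing `4`, then automorphisms preserve `⟨a⟩` and its
complement. -/
lemma IsCyclicExtension.mulAut_apply (h : IsCyclicExtension n k e a b) (hn : ¬ n ∣ 4)
    (h4 : ∀ i : ℤ, (n : ℤ) ∣ 2 * (i * (1 + k) + e)) (f : MulAut G) :
    (∃ i : ℤ, f a = a ^ i) ∧ ∃ j : ℤ, f b = a ^ j * b := by
  have key (f : MulAut G) : ∃ i : ℤ, f a = a ^ i := by
    obtain ⟨i, hi | hi⟩ := h.exists_zpow (f a)
    · exact ⟨i, hi⟩
    · refine (hn ?_).elim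
      rw [← h.orderOf_eq, ← MulEquiv.orderOf_eq f, hi]
      refine orderOf_dvd_of_pow_eq_one ?_
      have := h.zpow_mul_zpow_two_mul i 2
      rw [h.zpow_eq_one_iff.2 (by rw [mul_comm]; exact h4 i : (n : ℤ) ∣ (i * (1 + k) + e) * 2)] at this
      rwa [← zpow_ofNat]
  refine ⟨key f, ?_⟩
  obtain ⟨j, hj | hj⟩ := h.exists_zpow (f b)
  · obtain ⟨i, hi⟩ := key f⁻¹
    refine (h.notMem ⟨i * j, ?_⟩).elim
    simp only
    rw [zpow_mul, ← hi, ← map_zpow, ← hj, MulAut.inv_apply_self]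
  · exact ⟨j, hj⟩

variable [Finite G]

lemma IsCyclicExtension.mulAut_dihedral_quaternion (h : IsCyclicExtension (2 ^ ℓ) (-1) e a b)
    (hℓ : 3 ≤ ℓ) (he : 2 ^ ℓ ∣ 2 * e) :
    (∃ ρ₅ ρneg η : MulAut G, (ρ₅ a = a ^ 5 ∧ ρ₅ b = b) ∧ (ρneg a = a⁻¹ ∧ ρneg b = b) ∧
      (η a = a ∧ η b = a * b) ∧ Subgroup.closure {ρ₅, ρneg, η} = ⊤) ∧
    Nonempty (MulAut G ≃* Holomorph (Cyc (2 ^ ℓ))) := by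
  have hn : ¬ 2 ^ ℓ ∣ 4 := fun hd ↦ by
    have := Nat.le_of_dvd (by norm_num) ((pow_dvd_pow 2 hℓ).trans hd)
    omega
  have := h.mulAut_semidirect (m := 2 ^ ℓ) (s := 1) (by omega) dvd_rfl (one_mul _) (by simp) he
    fun f ↦ by
      simpa using h.mulAut_apply hn (fun i ↦ by simpa using he) f
  rw [cycAutAction_dvd_refl] at this
  simpa only [pow_one] using this

lemma IsCyclicExtension.mulAut_semidihedral
    (h : IsCyclicExtension (2 ^ ℓ) (2 ^ (ℓ - 1) - 1) 0 a b) (hℓ : 3 ≤ ℓ) :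
    (∃ ρ₅ ρneg η₀ : MulAut G, (ρ₅ a = a ^ 5 ∧ ρ₅ b = b) ∧ (ρneg a = a⁻¹ ∧ ρneg b = b) ∧
      (η₀ a = a ∧ η₀ b = a ^ 2 * b) ∧ Subgroup.closure {ρ₅, ρneg, η₀} = ⊤) ∧
    Nonempty (MulAut G ≃* HalfHolomorph ℓ) := by
  have hn : ¬ 2 ^ ℓ ∣ 4 := fun hd ↦ by
    have := Nat.le_of_dvd (by norm_num) ((pow_dvd_pow 2 hℓ).trans hd)
    omega
  have hpow : (2 : ℤ) ^ ℓ = 2 * 2 ^ (ℓ - 1) := by rw [← pow_succ', Nat.sub_add_cancel (by omega)]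
  refine h.mulAut_semidirect (m := 2 ^ (ℓ - 1)) (s := 2) (by omega) _
    (by rw [← pow_succ', Nat.sub_add_cancel (by omega)]) ⟨1, ?_⟩ (by simp) fun f ↦ ?_
  · rw [hpow]
    push_cast
    ring
  · obtain ⟨hi, j, hj⟩ := h.mulAut_apply hn (fun i ↦ ⟨i, by push_cast; rw [hpow]; ring⟩) f
    refine ⟨hi, ?_⟩
    have h1 : (f b) ^ 2 = 1 := by rw [← map_pow, h.sq_eq, zpow_zero, map_one]
    rw [hj, h.zpow_mul_sq, h.zpow_eq_one_iff] at h1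
    push_cast at h1
    rw [hpow, show j * (1 + (2 ^ (ℓ - 1) - 1)) + 0 = j * (2 : ℤ) ^ (ℓ - 1) by ring,
      mul_dvd_mul_iff_right (by positivity)] at h1
    obtain ⟨i, rfl⟩ := h1
    exact ⟨i, hj⟩

/-! ### Automorphism groups of `Z_{2 ^ ℓ} × Z_2` and of the modular group -/

lemma Int.five_pow_two_pow (m : ℕ) : ∃ t : ℤ, (5 : ℤ) ^ 2 ^ m = 1 + 4 * 2 ^ m + 8 * 2 ^ m * t := by
  induction m with
  | zero => exact ⟨0, by norm_num⟩
  | succ m ih =>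
    obtain ⟨t, ht⟩ := ih
    refine ⟨t + 2 ^ m * (1 + 2 * t) ^ 2, ?_⟩
    rw [pow_succ 2 m, pow_mul, ht, pow_succ (2 : ℤ) m]
    ring

/-- Both `Z_{2 ^ ℓ} × Z_2` and the modular group are of this form, with `k = 1` and
`k = 1 + 2 ^ (ℓ - 1)`. The automorphisms `σ` and `τ` are involutions whose commutator is the
automorphism `a ↦ a ^ (1 + 2 ^ (ℓ - 1))` of order `2` in `⟨ρ₅⟩`. -/
lemma IsCyclicExtension.mulAut_central {m : ℕ} {ε : ℤ}
    (h : IsCyclicExtension (2 ^ (m + 3)) (1 + 4 * 2 ^ m * ε) 0 a b) :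
    (∃ ρ₅ ρneg τ σ : MulAut G,
      (ρ₅ a = a ^ 5 ∧ ρ₅ b = b) ∧ (ρneg a = a⁻¹ ∧ ρneg b = b) ∧
      (τ a = a * b ∧ τ b = b) ∧ (σ a = a ∧ σ b = a ^ 2 ^ (m + 2) * b) ∧
      Subgroup.closure {ρ₅, ρneg, τ, σ} = ⊤) ∧
    IsCycCentralD8TimesZ2 (m + 3) (MulAut G) := by
  obtain ⟨Q, hQ⟩ : ∃ Q : ℤ, Q = 2 ^ m := ⟨_, rfl⟩
  have hQ0 : 0 < Q := by rw [hQ]; positivity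
  have hn : ((2 ^ (m + 3) : ℕ) : ℤ) = 8 * Q := by rw [hQ]; push_cast; ring
  rw [← hQ] at h
  have hz {i j : ℤ} (t : ℤ) (hij : i - j = 8 * Q * t) : a ^ i = a ^ j :=
    h.zpow_eq_zpow (hn ▸ ⟨t, hij⟩)
  have hbb : b * b = 1 := by rw [← pow_two, h.sq_eq, zpow_zero]
  have h2 (j : ℤ) : (a * b) ^ (2 * j) = a ^ ((2 + 4 * Q * ε) * j) := by
    have := h.zpow_mul_zpow_two_mul 1 j
    rw [zpow_one] at this
    rw [this]
    congr 1
    ring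
  obtain ⟨ρ, hρ⟩ := h.exists_powHom ⟨2 ^ (m + 2), by ring⟩ (by simp)
  obtain ⟨σ, hσa, hσb⟩ := h.exists_shift (s := 4 * Q)
    (hn ▸ ⟨1 + 2 * Q * ε, by ring⟩)
  have hσ := MulAut.zpow_apply_shift hσa hσb
  obtain ⟨τ, hτa, hτb⟩ : ∃ τ : MulAut G, τ a = a * b ∧ τ b = b := by
    refine h.exists_mulAut ⟨?_, ?_, ?_⟩ ?_
    · rw [← zpow_natCast, hn, show 8 * Q = 2 * (4 * Q) by ring, h2,
        hz (j := 0) (1 + 2 * Q * ε) (by ring), zpow_zero]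
    · rw [zpow_zero, pow_two, hbb]
    · rw [← mul_assoc, h.conj_eq, show 1 + 4 * Q * ε = 2 * (2 * Q * ε) + 1 by ring,
        zpow_add_one (a * b), h2, ← mul_assoc (a ^ _) a b, ← zpow_add_one]
      exact congrArg (· * b) (hz (Q * -ε ^ 2) (by ring))
    · rw [eq_top_iff, ← h.closure_eq, Subgroup.closure_le]
      have hb : b ∈ Subgroup.closure {a * b, b} := Subgroup.subset_closure (by simp)
      have hab : a * b ∈ Subgroup.closure {a * b, b} := Subgroup.subset_closure (by simp)
      rintro x (rfl | hx)
      · simpa using mul_mem hab (inv_mem hb)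
      · exact hx ▸ hb
  obtain ⟨v, hv, hvo, hvne, hvgen⟩ := ZMod.exists_unit_five (m + 1)
  have hρb (u) : ρ u b = b := (hρ u _ (ZMod.intCast_zmod_cast _).symm).2
  have hρinj : Function.Injective ρ := by
    rw [injective_iff_map_eq_one]
    intro u hu
    obtain ⟨j, hj⟩ := ZMod.intCast_surjective (u : ZMod (2 ^ (m + 3)))
    have := (hρ u j hj.symm).1
    rw [hu, MulAut.one_apply] at this
    have h1 := h.zpow_eq_zpow_iff.1 (this.symm.trans (zpow_one a).symm)
    rw [← ZMod.intCast_zmod_eq_zero_iff_dvd] at h1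
    ext
    rw [← hj, Units.val_one, ← sub_eq_zero, ← h1]
    simp
  have hpa : ρ v a = a ^ (5 : ℤ) := (hρ v 5 (by simpa using hv)).1
  have hwa : ρ (-1) a = a⁻¹ := by simpa using (hρ (-1) (-1) (by simp)).1
  have hpz (i : ℤ) : ρ v (a ^ i) = a ^ (5 * i) := by rw [map_zpow, hpa, zpow_mul]
  have hwz (i : ℤ) : ρ (-1) (a ^ i) = a ^ (-i) := by rw [map_zpow, hwa, inv_zpow']
  have hσz (i : ℤ) : σ (a ^ i) = a ^ i := by rw [map_zpow, hσa]
  have hτodd (t : ℤ) : τ (a ^ (2 * t + 1)) = a ^ ((2 + 4 * Q * ε) * t + 1) * b := by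
    rw [map_zpow, hτa, zpow_add_one, h2, ← mul_assoc, zpow_add_one]
  have hτz (t : ℤ) : τ (a ^ (4 * Q * t)) = a ^ (4 * Q * t) := by
    rw [map_zpow, hτa, show 4 * Q * t = 2 * (2 * Q * t) by ring, h2]
    exact hz (Q * ε * t) (by ring)
  have hgen : Subgroup.closure {ρ v, ρ (-1), τ, σ} = ⊤ := by
    have hρmem (u) : ρ u ∈ Subgroup.closure {ρ v, ρ (-1), τ, σ} := by
      obtain ⟨j, rfl | rfl⟩ := hvgen u
      · rw [map_zpow]
        exact zpow_mem (Subgroup.subset_closure (by simp)) _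
      · rw [map_mul, map_zpow]
        exact mul_mem (Subgroup.subset_closure (by simp))
          (zpow_mem (Subgroup.subset_closure (by simp)) _)
    have hfix (f : MulAut G) (hf : f a = a) : f ∈ Subgroup.closure {ρ v, ρ (-1), τ, σ} := by
      obtain ⟨j, hj | hj⟩ := h.exists_zpow (f b)
      · refine (h.notMem ⟨j, f.injective ?_⟩).elim
        rw [map_zpow, hf, hj]
      · have h1 : (f b) ^ 2 = 1 := by rw [← map_pow, h.sq_eq, zpow_zero, map_one]
        rw [hj, h.zpow_mul_sq, h.zpow_eq_one_iff, hn] at h1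
        -- `1 + 2 * Q * ε` is invertible modulo `4 * Q`, with inverse `1 - 2 * Q * ε`
        obtain ⟨t, ht⟩ := h1
        have ht' : j * (1 + 2 * Q * ε) = 4 * Q * t := by linarith
        obtain ⟨y, hy⟩ : 4 * Q ∣ j := by
          refine ⟨t * (1 - 2 * Q * ε) + j * Q * ε ^ 2, ?_⟩
          linear_combination (1 - 2 * Q * ε) * ht'
        have : f = σ ^ y := h.mulAut_ext (by rw [hf, (hσ y).1]) (by rw [hj, (hσ y).2, hy])
        rw [this]
        exact zpow_mem (Subgroup.subset_closure (by simp)) _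
    have hpres (f : MulAut G) {i : ℤ} (hf : f a = a ^ i) :
        f ∈ Subgroup.closure {ρ v, ρ (-1), τ, σ} := by
      obtain ⟨u, hu⟩ := h.isUnit_of_apply hf
      have hfa : ((ρ u)⁻¹ * f) a = a := by
        change (ρ u).symm (f a) = a
        rw [MulEquiv.symm_apply_eq, hf, (hρ u i hu).1]
      simpa using mul_mem (hρmem u) (hfix _ hfa)
    rw [eq_top_iff]
    rintro f -
    obtain ⟨i, hi | hi⟩ := h.exists_zpow (f a)
    · exact hpres f hi
    · obtain ⟨t, rfl | rfl⟩ := Int.even_or_odd' i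
      · have h1 : f (a ^ (2 * (2 * Q))) = 1 := by
          rw [map_zpow, hi, h.zpow_mul_zpow_two_mul]
          exact (hz (j := 0) (t * (1 + 2 * Q * ε)) (by ring)).trans (zpow_zero a)
        rw [EmbeddingLike.map_eq_one_iff, h.zpow_eq_one_iff, hn] at h1
        have := Int.le_of_dvd (by positivity) h1
        omega
      · have := hpres (τ * f) (i := (2 + 4 * Q * ε) * t + 1)
          (by rw [MulAut.mul_apply, hi, map_mul, hτodd, hτb, mul_assoc, hbb, mul_one])
        have hτm : τ ∈ Subgroup.closure {ρ v, ρ (-1), τ, σ} := Subgroup.subset_closure (by simp)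
        simpa using mul_mem (inv_mem hτm) this
  refine ⟨⟨ρ v, ρ (-1), τ, σ, ⟨by exact_mod_cast hpa, hρb v⟩, ⟨hwa, hρb _⟩, ⟨hτa, hτb⟩,
    ⟨hσa, ?_⟩, hgen⟩, ?_⟩
  · rw [hσb, ← zpow_natCast, hQ]
    congr 2
    push_cast
    ring
  have hpσ : Commute (ρ v) σ := by
    refine h.mulAut_ext ?_ ?_
    · rw [MulAut.mul_apply, MulAut.mul_apply, hσa, hpa, hσz]
    · rw [MulAut.mul_apply, MulAut.mul_apply, hσb, map_mul, hpz, hρb, hσb]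
      exact congrArg (· * b) (hz 2 (by ring))
  have hwσ : Commute (ρ (-1)) σ := by
    refine h.mulAut_ext ?_ ?_
    · rw [MulAut.mul_apply, MulAut.mul_apply, hσa, hwa, map_inv, hσa]
    · rw [MulAut.mul_apply, MulAut.mul_apply, hσb, map_mul, hwz, hρb, hσb]
      exact congrArg (· * b) (hz (-1) (by ring))
  -- in the modular group, `ρ (-1)` has to be corrected by `σ` to commute with `τ`
  obtain ⟨c, hc⟩ : ∃ c : MulAut G, c = ρ (-1) * σ ^ ε := ⟨_, rfl⟩
  have hca : c a = a⁻¹ := by rw [hc, MulAut.mul_apply, (hσ ε).1, hwa]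
  have hcz (i : ℤ) : c (a ^ i) = a ^ (-i) := by rw [map_zpow, hca, inv_zpow']
  have hcb : c b = a ^ (4 * Q * -ε) * b := by
    rw [hc, MulAut.mul_apply, (hσ ε).2, map_mul, hwz, hρb, mul_neg]
  have hcc : c ^ 2 = 1 := by
    rw [pow_two]
    refine h.mulAut_ext ?_ ?_
    · rw [MulAut.mul_apply, hca, map_inv, hca, inv_inv, MulAut.one_apply]
    · rw [MulAut.mul_apply, hcb, map_mul, hcz, hcb, ← mul_assoc, ← zpow_add, neg_add_cancel,
        zpow_zero, one_mul, MulAut.one_apply]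
  have hσσ : σ ^ 2 = 1 := by
    have := hσ 2
    rw [zpow_ofNat] at this
    refine h.mulAut_ext this.1 ?_
    rw [this.2, hz (j := 0) 1 (by ring), zpow_zero, one_mul, MulAut.one_apply]
  have hττ : τ ^ 2 = 1 := by
    rw [pow_two]
    refine h.mulAut_ext ?_ ?_
    · rw [MulAut.mul_apply, hτa, map_mul, hτa, hτb, mul_assoc, hbb, mul_one, MulAut.one_apply]
    · rw [MulAut.mul_apply, hτb, hτb, MulAut.one_apply]
  have hpτ : Commute (ρ v) τ := by
    refine h.mulAut_ext ?_ ?_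
    · rw [MulAut.mul_apply, MulAut.mul_apply, hτa, map_mul, hpa, hρb,
        show (5 : ℤ) = 2 * 2 + 1 by norm_num, hτodd]
      exact congrArg (· * b) (hz (-ε) (by ring))
    · rw [MulAut.mul_apply, MulAut.mul_apply, hτb, hρb, hτb]
  have hστ : (σ * τ) ^ 2 = ρ v ^ 2 ^ m := by
    obtain ⟨t, ht⟩ := Int.five_pow_two_pow m
    rw [← hQ] at ht
    have hst : (σ * τ) a = a ^ (1 + 4 * Q) * b := by
      rw [MulAut.mul_apply, hτa, map_mul, hσa, hσb, ← mul_assoc, ← zpow_one_add]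
    have hst' : (σ * τ) b = a ^ (4 * Q) * b := by rw [MulAut.mul_apply, hτb, hσb]
    have hst2 : (σ * τ) (a ^ (4 * Q)) = a ^ (4 * Q) := by
      have := hτz 1
      rw [mul_one] at this
      rw [MulAut.mul_apply, this, hσz]
    rw [← map_pow]
    refine h.mulAut_ext ?_ ?_
    · have hst3 : (σ * τ) (a ^ (1 + 4 * Q)) = a ^ (1 + 4 * Q) * b * a ^ (4 * Q) := by
        rw [zpow_add, map_mul, zpow_one, hst, hst2, zpow_add, zpow_one]
      rw [pow_two, MulAut.mul_apply, hst, map_mul, hst3, hst',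
        (hρ (v ^ 2 ^ m) (5 ^ 2 ^ m) (by push_cast; rw [hv])).1, ht, mul_assoc _ (a ^ (4 * Q)),
        ← mul_assoc (a ^ (4 * Q)), ← zpow_add, hz (i := 4 * Q + 4 * Q) (j := 0) 1 (by ring),
        zpow_zero, one_mul, mul_assoc, hbb, mul_one]
      exact hz (-t) (by ring)
    · rw [pow_two, MulAut.mul_apply, hst', map_mul, hst', hst2, hρb, ← mul_assoc, ← zpow_add,
        hz (j := 0) 1 (by ring), zpow_zero, one_mul]
  have hp : orderOf (ρ v) = 2 ^ (m + 1) := by rw [orderOf_injective ρ hρinj, hvo]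
  refine isCycCentralD8TimesZ2_of_generators hp hσσ hττ hcc hστ hpσ hpτ ?_ ?_ ?_ ?_ ?_
  · rw [hc]
    exact ((Commute.all v (-1)).map ρ).mul_right (hpσ.zpow_right ε)
  · rw [hc]
    exact hwσ.symm.mul_right (Commute.self_zpow σ ε)
  · refine h.mulAut_ext ?_ ?_
    · rw [MulAut.mul_apply, MulAut.mul_apply, hca, hτa, map_mul, hca, hcb, ← zpow_neg_one,
        show (-1 : ℤ) = 2 * (-1) + 1 by norm_num, hτodd, ← mul_assoc, ← zpow_add]
      congr 2
      ring
    · rw [MulAut.mul_apply, MulAut.mul_apply, hτb, hcb, map_mul, hτz, hτb]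
  · rw [eq_top_iff, ← hgen, Subgroup.closure_le]
    have hσm : σ ∈ Subgroup.closure {ρ v, σ, τ, c} := Subgroup.subset_closure (by simp)
    have hcm : c ∈ Subgroup.closure {ρ v, σ, τ, c} := Subgroup.subset_closure (by simp)
    rintro x (hx | hx | hx | hx) <;> rw [hx]
    · exact Subgroup.subset_closure (by simp)
    · have := mul_mem hcm (inv_mem (zpow_mem hσm ε))
      have hcσ : c * (σ ^ ε)⁻¹ = ρ (-1) := by rw [hc, mul_inv_cancel_right]
      rwa [hcσ] at this
    · exact Subgroup.subset_closure (by simp)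
    · exact hσm
  · intro x i j y hxy
    have hpx (g : ℤ) : ∃ g' : ℤ, (ρ v ^ x) (a ^ g) = a ^ g' := by
      obtain ⟨r, hr⟩ := ZMod.intCast_surjective ((v ^ x : (ZMod (2 ^ (m + 3)))ˣ) :
        ZMod (2 ^ (m + 3)))
      refine ⟨r * g, ?_⟩
      rw [← map_zpow ρ, map_zpow, (hρ _ r hr.symm).1, zpow_mul]
    have hpb : (ρ v ^ x) b = b := by rw [← map_zpow ρ, hρb]
    have hcy : ∃ t : ℤ, (c ^ y) a = a ^ (2 * t + 1) := by
      obtain ⟨y, rfl | rfl⟩ := Int.even_or_odd' y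
      · exact ⟨0, by rw [zpow_mul, zpow_ofNat, hcc, one_zpow, MulAut.one_apply]; simp⟩
      · exact ⟨-1, by rw [zpow_add_one, zpow_mul, zpow_ofNat, hcc, one_zpow, one_mul, hca]; simp⟩
    -- the value at `a` shows that `j` is even
    have hj : 2 ∣ j := by
      obtain ⟨j, rfl | rfl⟩ := Int.even_or_odd' j
      · exact ⟨j, rfl⟩
      · exfalso
        obtain ⟨t, ht⟩ := hcy
        have ha := DFunLike.congr_fun hxy a
        rw [zpow_add_one, zpow_mul τ, zpow_ofNat, hττ, one_zpow, one_mul, MulAut.mul_apply, ht,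
          MulAut.mul_apply, hτodd, MulAut.mul_apply, map_mul, map_zpow, (hσ i).1, (hσ i).2,
          ← mul_assoc, ← zpow_add, map_mul, hpb, MulAut.one_apply] at ha
        obtain ⟨g, hg⟩ := hpx ((2 + 4 * Q * ε) * t + 1 + 4 * Q * i)
        rw [hg, ← zpow_one a, ← zpow_mul, one_mul] at ha
        exact h.zpow_mul_ne_zpow _ _ ha
    rw [zpow_eq_one_of_two_dvd hττ hj, mul_one] at hxy
    -- if `y` were odd, the value at `a` would make `-1` a power of `5`
    have hy : 2 ∣ y := by
      obtain ⟨y, rfl | rfl⟩ := Int.even_or_odd' y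
      · exact ⟨y, rfl⟩
      · exfalso
        have ha := DFunLike.congr_fun hxy a
        rw [zpow_add_one, zpow_mul c, zpow_ofNat, hcc, one_zpow, one_mul, MulAut.mul_apply, hca,
          MulAut.mul_apply, map_inv, (hσ i).1] at ha
        have h1 : ρ (v ^ x * -1) = 1 := by
          refine h.mulAut_ext ?_ ?_
          · rw [map_mul, MulAut.mul_apply, hwa, map_zpow, ha]
          · rw [hρb, MulAut.one_apply]
        have h2 := (injective_iff_map_eq_one ρ).1 hρinj _ h1
        refine hvne x ?_
        rw [mul_neg, mul_one, neg_eq_iff_eq_neg] at h2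
        exact h2
    rw [zpow_eq_one_of_two_dvd hcc hy, mul_one, mul_eq_one_iff_eq_inv'] at hxy
    refine ⟨?_, hj, hy⟩
    have hb := (hσ i).2
    rw [hxy, ← zpow_neg, ← map_zpow, hρb, right_eq_mul, h.zpow_eq_one_iff, hn,
      show 8 * Q = 4 * Q * 2 by ring, mul_dvd_mul_iff_left (by positivity)] at hb
    exact hb

end

/-! ### The cyclic group -/

section

variable {G : Type*} [Group G] {n : ℕ} {a : G}

lemma exists_cyc_mulEquiv (ha : orderOf a = n) (hcl : Subgroup.zpowers a = ⊤) :
    ∃ f : Cyc n ≃* G, ∀ i : ℤ, f (Multiplicative.ofAdd (i : ZMod n)) = a ^ i := by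
  obtain ⟨f, hf⟩ := exists_cycHom (n := n) (g := a) (ha ▸ pow_orderOf_eq_one a)
  refine ⟨MulEquiv.ofBijective f ⟨?_, fun x ↦ ?_⟩, hf⟩
  · rw [injective_iff_map_eq_one]
    intro x hx
    obtain ⟨i, rfl⟩ := cyc_exists_int x
    rw [hf, ← orderOf_dvd_iff_zpow_eq_one, ha] at hx
    rw [(ZMod.intCast_zmod_eq_zero_iff_dvd i n).2 hx, ofAdd_zero]
  · obtain ⟨i, rfl⟩ := Subgroup.mem_zpowers_iff.1 (hcl ▸ Subgroup.mem_top x : x ∈ Subgroup.zpowers a)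
    exact ⟨_, hf i⟩

lemma mulAut_cyclic {ℓ : ℕ} (ha : orderOf a = 2 ^ ℓ) (hcl : Subgroup.zpowers a = ⊤) (hℓ : 2 ≤ ℓ) :
    (∃ ρ₅ ρneg : MulAut G, ρ₅ a = a ^ 5 ∧ ρneg a = a⁻¹ ∧ Subgroup.closure {ρ₅, ρneg} = ⊤) ∧
      Nonempty (MulAut G ≃* Cyc (2 ^ (ℓ - 2)) × Cyc 2) := by
  obtain ⟨m, rfl⟩ := Nat.exists_eq_add_of_le' hℓ
  obtain ⟨f, hf⟩ := exists_cyc_mulEquiv ha hcl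
  obtain ⟨v, hv, hvo, hvne, hvgen⟩ := ZMod.exists_unit_five m
  let E : (ZMod (2 ^ (m + 2)))ˣ ≃* MulAut G := (cycAutEquivUnits _).symm.trans (MulAut.congr f)
  have hE (u : (ZMod (2 ^ (m + 2)))ˣ) (i : ℤ) (hu : (u : ZMod (2 ^ (m + 2))) = i) :
      E u a = a ^ i := by
    have h1 : f.symm a = Multiplicative.ofAdd 1 := by
      rw [MulEquiv.symm_apply_eq]
      simpa using (hf 1).symm
    change f ((cycAutEquivUnits _).symm u (f.symm a)) = a ^ i
    rw [h1, cycAutEquivUnits_symm_apply, mul_one, hu, hf]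
  constructor
  · refine ⟨E v, E (-1), ?_, ?_, ?_⟩
    · exact_mod_cast hE v 5 (by simpa using hv)
    · simpa using hE (-1) (-1) (by simp)
    · rw [eq_top_iff]
      rintro x -
      obtain ⟨u, rfl⟩ := E.surjective x
      obtain ⟨j, rfl | rfl⟩ := hvgen u
      · rw [map_zpow]
        exact zpow_mem (Subgroup.subset_closure (by simp)) _
      · rw [map_mul, map_zpow]
        exact mul_mem (Subgroup.subset_closure (by simp))
          (zpow_mem (Subgroup.subset_closure (by simp)) _)
  · obtain ⟨P, hP⟩ := exists_cycHom (hvo ▸ pow_orderOf_eq_one v)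
    have h2 : (-1 : (ZMod (2 ^ (m + 2)))ˣ) ^ 2 = 1 := by simp
    obtain ⟨N, hN⟩ := exists_cycHom h2
    let F := P.noncommCoprod N fun _ _ ↦ Commute.all _ _
    have hF (i j : ℤ) : F (Multiplicative.ofAdd (i : ZMod (2 ^ m)),
        Multiplicative.ofAdd (j : ZMod 2)) = v ^ i * (-1) ^ j := by
      rw [MonoidHom.noncommCoprod_apply, hP, hN]
    refine ⟨E.symm.trans (MulEquiv.ofBijective F ⟨?_, fun u ↦ ?_⟩).symm⟩
    · rw [injective_iff_map_eq_one]
      rintro ⟨x, y⟩ hxy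
      obtain ⟨i, rfl⟩ := cyc_exists_int x
      obtain ⟨j, rfl⟩ := cyc_exists_int y
      rw [hF] at hxy
      have hj : 2 ∣ j := by
        obtain ⟨j, rfl | rfl⟩ := Int.even_or_odd' j
        · exact ⟨j, rfl⟩
        · rw [zpow_add_one, zpow_mul, zpow_ofNat, h2, one_zpow, one_mul, mul_neg, mul_one,
            neg_eq_iff_eq_neg] at hxy
          exact (hvne i hxy).elim
      rw [zpow_eq_one_of_two_dvd h2 hj, mul_one, ← orderOf_dvd_iff_zpow_eq_one, hvo] at hxy
      rw [(ZMod.intCast_zmod_eq_zero_iff_dvd i _).2 hxy, (ZMod.intCast_zmod_eq_zero_iff_dvd j _).2 hj]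
      rfl
    · obtain ⟨j, rfl | rfl⟩ := hvgen u
      · exact ⟨_, (hF j 0).trans (by simp)⟩
      · exact ⟨_, (hF j 1).trans (by rw [zpow_one, mul_comm])⟩

end

/-! ### Classification -/

lemma Cyc.isCyclicExtension_prod (n : ℕ) :
    IsCyclicExtension n 1 0 ((Multiplicative.ofAdd 1, 1) : Cyc n × Cyc 2)
      (1, Multiplicative.ofAdd 1) where
  pow_eq_one := Prod.ext (cyc_one_pow n) (one_pow _)
  sq_eq := by
    rw [zpow_zero]
    exact Prod.ext (one_pow _) (cyc_one_pow 2)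
  conj_eq := by rw [mul_right_comm, inv_mul_cancel, one_mul, zpow_one]
  orderOf_eq := (orderOf_injective (MonoidHom.inl (Cyc n) (Cyc 2))
    (fun _ _ h ↦ congrArg Prod.fst h) _).trans (orderOf_cyc_one n)
  notMem := by
    rintro ⟨i, hi⟩
    have := congrArg Prod.snd hi
    simp only [Prod.pow_snd, one_zpow] at this
    exact absurd this (by decide)
  closure_eq := by
    rw [eq_top_iff]
    rintro ⟨x, y⟩ -
    obtain ⟨i, rfl⟩ := cyc_exists_int x
    obtain ⟨j, rfl⟩ := cyc_exists_int y
    rw [Subgroup.mem_closure_pair]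
    refine ⟨i, j, Prod.ext ?_ ?_⟩ <;> simp [← ofAdd_zsmul]

namespace IsCyclicExtension

variable {G : Type*} [Group G] {n ℓ m : ℕ} {k e : ℤ} {a b : G}

lemma shift (h : IsCyclicExtension n k e a b) (s : ℤ) :
    IsCyclicExtension n k (s * (1 + k) + e) a (a ^ s * b) where
  pow_eq_one := h.pow_eq_one
  sq_eq := h.zpow_mul_sq s
  conj_eq := by
    rw [← h.conj_eq]
    group
  orderOf_eq := h.orderOf_eq
  notMem := fun ⟨i, hi⟩ ↦ h.zpow_mul_ne_zpow s i hi.symm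
  closure_eq := by
    rw [eq_top_iff, ← h.closure_eq, Subgroup.closure_le]
    have ha : a ∈ Subgroup.closure {a, a ^ s * b} := Subgroup.subset_closure (by simp)
    have hb : a ^ s * b ∈ Subgroup.closure {a, a ^ s * b} := Subgroup.subset_closure (by simp)
    rintro x (hx | hx) <;> rw [hx]
    · exact ha
    · simpa using mul_mem (inv_mem (zpow_mem ha s)) hb

lemma dvd_sq_sub_one (h : IsCyclicExtension n k e a b) : (n : ℤ) ∣ k * k - 1 := by
  rw [← h.zpow_eq_zpow_iff, ← h.zpow_mul_mul 1, mul_one]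

lemma dvd_mul_sub_one (h : IsCyclicExtension n k e a b) : (n : ℤ) ∣ e * (k - 1) := by
  have h1 := h.conj_zpow e
  rw [← h.sq_eq, pow_two, inv_mul_cancel_left, ← pow_two, h.sq_eq] at h1
  rw [mul_sub, mul_one, mul_comm, ← h.zpow_eq_zpow_iff, h1]

lemma normal_zpowers (h : IsCyclicExtension n k e a b) : (Subgroup.zpowers a).Normal where
  conj_mem := by
    rintro _ ⟨j, rfl⟩ g
    obtain ⟨i, rfl | rfl⟩ := h.exists_zpow g
    · exact mul_mem (mul_mem ⟨i, rfl⟩ ⟨j, rfl⟩) (inv_mem ⟨i, rfl⟩)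
    · refine ⟨k * j, ?_⟩
      simp only [mul_inv_rev]
      rw [mul_assoc (a ^ i), h.mul_zpow]
      group

lemma isCyclicSplit (h : IsCyclicExtension (2 ^ ℓ) k 0 a b) : IsCyclicSplit ℓ k a b := by
  have hsq : b ^ 2 = 1 := by rw [h.sq_eq, zpow_zero]
  refine ⟨h.orderOf_eq, orderOf_eq_prime hsq fun hb ↦ h.notMem (hb ▸ one_mem _), h.normal_zpowers,
    Subgroup.isComplement'_of_disjoint_and_mul_eq_univ ?_ ?_, h.conj_eq⟩
  · rw [Subgroup.disjoint_def]
    rintro _ hx ⟨j, rfl⟩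
    obtain ⟨t, rfl | rfl⟩ := Int.even_or_odd' j
    · simp [zpow_mul, hsq]
    · simp only [zpow_add_one, zpow_mul, zpow_ofNat, hsq, one_zpow, one_mul] at hx
      exact (h.notMem hx).elim
  · rw [Set.eq_univ_iff_forall]
    intro g
    obtain ⟨i, rfl | rfl⟩ := h.exists_zpow g
    · exact ⟨_, ⟨i, rfl⟩, 1, one_mem _, mul_one _⟩
    · exact ⟨_, ⟨i, rfl⟩, b, Subgroup.mem_zpowers b, rfl⟩

/-- If `a ^ i * b` is an involution only for even `i`, then all involutions lie in the kernel of the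
homomorphism to `ℤˣ` with `a ↦ -1` and `b ↦ 1`. -/
lemma closure_involutions_ne_top (h : IsCyclicExtension n k e a b) (hn : 4 ∣ n) (he : 2 ∣ e)
    (hinv : ∀ i : ℤ, (n : ℤ) ∣ i * (1 + k) + e → 2 ∣ i) :
    Subgroup.closure {x : G | orderOf x = 2} ≠ ⊤ := by
  have hn4 : (4 : ℤ) ∣ n := by exact_mod_cast hn
  have h1 : (-1 : ℤˣ) ^ 2 = 1 := by simp
  have hk : 2 ∣ k - 1 := by
    have h2 : (2 : ℤ) ∣ k * k - 1 := (dvd_trans (by norm_num) hn4).trans h.dvd_sq_sub_one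
    have h3 : Odd (k * k) := by
      rw [← Int.not_even_iff_odd, even_iff_two_dvd]
      omega
    obtain ⟨t, ht⟩ := (Int.odd_mul.1 h3).1
    exact ⟨t, by omega⟩
  obtain ⟨χ, hχa, hχb⟩ := h.exists_hom (a' := (-1 : ℤˣ)) (b' := 1)
    ⟨by rw [← zpow_natCast]; exact zpow_eq_one_of_two_dvd h1 (dvd_trans (by norm_num) hn4),
      by rw [zpow_eq_one_of_two_dvd h1 he, one_pow],
      by rw [← sub_add_cancel k 1, zpow_add_one, zpow_eq_one_of_two_dvd h1 hk]; simp⟩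
  intro htop
  have hker : Subgroup.closure {x : G | orderOf x = 2} ≤ χ.ker := by
    rw [Subgroup.closure_le]
    intro x hx
    have hx2 : x ^ 2 = 1 := hx ▸ pow_orderOf_eq_one x
    rw [SetLike.mem_coe, MonoidHom.mem_ker]
    obtain ⟨i, rfl | rfl⟩ := h.exists_zpow x
    · rw [← zpow_natCast, ← zpow_mul, h.zpow_eq_one_iff] at hx2
      rw [map_zpow, hχa]
      have := hn4.trans hx2
      exact zpow_eq_one_of_two_dvd h1 (by omega)
    · rw [h.zpow_mul_sq, h.zpow_eq_one_iff] at hx2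
      rw [map_mul, map_zpow, hχa, hχb, mul_one]
      exact zpow_eq_one_of_two_dvd h1 (hinv i hx2)
  have ha : a ∈ χ.ker := hker (htop ▸ Subgroup.mem_top a)
  rw [MonoidHom.mem_ker, hχa] at ha
  exact absurd ha (by decide)

end IsCyclicExtension

lemma closure_involutions_ne_top_of_zpowers_eq_top {G : Type*} [Group G] {n : ℕ} {c : G}
    (hcl : Subgroup.zpowers c = ⊤) (hc : orderOf c = n) (hn : 2 < n) :
    Subgroup.closure {x : G | orderOf x = 2} ≠ ⊤ := by
  intro htop
  have hcomm (x y : G) : Commute x y := by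
    obtain ⟨i, rfl⟩ := Subgroup.mem_zpowers_iff.1 (hcl ▸ Subgroup.mem_top x : x ∈ Subgroup.zpowers c)
    obtain ⟨j, rfl⟩ := Subgroup.mem_zpowers_iff.1 (hcl ▸ Subgroup.mem_top y : y ∈ Subgroup.zpowers c)
    exact Commute.zpow_zpow_self c i j
  have hsq (x : G) : x ^ 2 = 1 := by
    have hx : x ∈ Subgroup.closure {x : G | orderOf x = 2} := htop ▸ Subgroup.mem_top x
    induction hx using Subgroup.closure_induction with
    | mem x hx => exact hx ▸ pow_orderOf_eq_one x
    | one => exact one_pow 2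
    | mul x y _ _ hx hy => rw [(hcomm x y).mul_pow, hx, hy, mul_one]
    | inv x _ hx => rw [inv_pow, hx, inv_one]
  have := Nat.le_of_dvd two_pos (orderOf_dvd_of_pow_eq_one (hsq c))
  omega

/-- The square roots of `1` modulo `2 ^ (m + 3)`. -/
lemma Int.sq_eq_one_mod_two_pow {m : ℕ} {k : ℤ} (hk : 8 * 2 ^ m ∣ k * k - 1) :
    8 * 2 ^ m ∣ k - 1 ∨ 8 * 2 ^ m ∣ k - (-1) ∨ 8 * 2 ^ m ∣ k - (4 * 2 ^ m - 1) ∨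
      8 * 2 ^ m ∣ k - (4 * 2 ^ m + 1) := by
  have h2 : (2 : ℤ) ∣ k * k - 1 := (Dvd.intro (4 * 2 ^ m) (by ring)).trans hk
  have h3 : Odd (k * k) := by
    rw [← Int.not_even_iff_odd, even_iff_two_dvd]
    omega
  obtain ⟨j, rfl⟩ := (Int.odd_mul.1 h3).1
  have h4 : 2 * 2 ^ m ∣ j * (j + 1) := by
    obtain ⟨t, ht⟩ := hk
    exact ⟨t, by linarith⟩
  -- one of the two consecutive numbers is odd, so the other one takes the whole power of `2`
  have h5 : 2 * 2 ^ m ∣ j ∨ 2 * 2 ^ m ∣ j + 1 := by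
    rw [← pow_succ'] at h4 ⊢
    have hodd {i : ℤ} (hi : Odd i) : IsCoprime ((2 : ℤ) ^ (m + 1)) i :=
      IsCoprime.pow_left (Int.isCoprime_two_left.2 hi)
    rcases Int.even_or_odd j with hj | hj
    · exact .inl ((hodd hj.add_one).dvd_of_dvd_mul_right h4)
    · exact .inr ((hodd hj).dvd_of_dvd_mul_left h4)
  rcases h5 with ⟨t, ht⟩ | ⟨t, ht⟩ <;> obtain ⟨s, rfl | rfl⟩ := Int.even_or_odd' t
  · exact .inl ⟨s, by linarith⟩
  · exact .inr (.inr (.inr ⟨s, by linarith⟩))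
  · exact .inr (.inl ⟨s, by linarith⟩)
  · exact .inr (.inr (.inl ⟨s, by linarith⟩))

/-- The classification of the groups with a cyclic subgroup of index `2` and order `2 ^ (m + 3)`. The
class of `k` is a square root of `1`; replacing `b` by `a ^ s * b` normalizes `e`. -/
lemma IsCyclicExtension.classification {G : Type*} [Group G] {m : ℕ} {k e : ℤ} {a b : G}
    (h : IsCyclicExtension (2 ^ (m + 3)) k e a b) :
    (∃ c : G, orderOf c = 2 ^ (m + 4) ∧ Subgroup.zpowers c = ⊤) ∨
    (∃ b : G, IsCyclicExtension (2 ^ (m + 3)) 1 0 a b) ∨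
    (∃ b : G, IsCyclicExtension (2 ^ (m + 3)) (-1) 0 a b) ∨
    (∃ b : G, IsCyclicExtension (2 ^ (m + 3)) (4 * 2 ^ m - 1) 0 a b) ∨
    (∃ b : G, IsCyclicExtension (2 ^ (m + 3)) (4 * 2 ^ m + 1) 0 a b) ∨
    (∃ b : G, IsCyclicExtension (2 ^ (m + 3)) (-1) (4 * 2 ^ m) a b) := by
  have hn : ((2 ^ (m + 3) : ℕ) : ℤ) = 8 * 2 ^ m := by push_cast; ring
  have hk := h.dvd_sq_sub_one
  rw [hn] at hk
  rcases Int.sq_eq_one_mod_two_pow hk with hk | hk | hk | hk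
  · replace h := h.congr_exponents (hn ▸ hk) (e' := e) (by simp)
    obtain ⟨t, rfl | rfl⟩ := Int.even_or_odd' e
    · exact .inr (.inl ⟨_, (h.shift (-t)).congr_exponents (by simp) ⟨0, by ring⟩⟩)
    · refine .inl ⟨b, orderOf_eq_prime_pow ?_ ?_, ?_⟩
      · rw [pow_succ', pow_mul, h.sq_eq, ← zpow_natCast, ← zpow_mul, h.zpow_eq_one_iff, hn]
        push_cast
        rw [show (2 * t + 1) * (2 : ℤ) ^ (m + 2) = (2 * t + 1) * (4 * 2 ^ m) by ring,
          show (8 : ℤ) * 2 ^ m = 2 * (4 * 2 ^ m) by ring, mul_dvd_mul_iff_right (by positivity)]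
        omega
      · rw [pow_succ', pow_mul, h.sq_eq, ← zpow_natCast, ← zpow_mul, h.zpow_eq_one_iff]
        exact Dvd.intro_left _ rfl
      · have hco : IsCoprime ((2 : ℤ) ^ (m + 3)) (2 * t + 1) :=
          IsCoprime.pow_left (Int.isCoprime_two_left.2 ⟨t, rfl⟩)
        obtain ⟨x, y, hxy⟩ := hco
        have ha : a ∈ Subgroup.zpowers b := by
          refine ⟨2 * y, ?_⟩
          simp only
          rw [zpow_mul, zpow_ofNat, h.sq_eq, ← zpow_mul]
          refine (h.zpow_eq_zpow_iff.2 ?_).trans (zpow_one a)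
          exact ⟨-x, by push_cast; linarith⟩
        rw [eq_top_iff, ← h.closure_eq, Subgroup.closure_le]
        rintro x (hx | hx) <;> rw [hx]
        exacts [ha, Subgroup.mem_zpowers b]
  · replace h := h.congr_exponents (hn ▸ hk) (e' := e) (by simp)
    obtain ⟨y, hy⟩ := hn ▸ h.dvd_mul_sub_one
    obtain ⟨t, rfl | rfl⟩ := Int.even_or_odd' y
    · exact .inr (.inr (.inl ⟨b, h.congr_exponents (by simp) ⟨-t, by rw [hn]; linarith⟩⟩))
    · exact .inr (.inr (.inr (.inr (.inr
        ⟨b, h.congr_exponents (by simp) ⟨-t - 1, by rw [hn]; linarith⟩⟩))))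
  · replace h := h.congr_exponents (hn ▸ hk) (e' := e) (by simp)
    obtain ⟨y, hy⟩ := hn ▸ h.dvd_mul_sub_one
    obtain ⟨t, rfl⟩ : 4 * 2 ^ m ∣ e := by
      -- `2 * 2 ^ m - 1` is invertible modulo `4 * 2 ^ m`, with inverse `-2 * 2 ^ m - 1`
      refine ⟨e * 2 ^ m - y * (2 * 2 ^ m + 1), ?_⟩
      have hy' : e * (2 * 2 ^ m - 1) = 4 * 2 ^ m * y := by linarith
      linear_combination (-(2 * 2 ^ m + 1)) * hy'
    exact .inr (.inr (.inr (.inl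
      ⟨_, (h.shift t).congr_exponents (by simp) ⟨t, by rw [hn]; ring⟩⟩)))
  · replace h := h.congr_exponents (hn ▸ hk) (e' := e) (by simp)
    obtain ⟨y, hy⟩ := hn ▸ h.dvd_mul_sub_one
    obtain rfl : e = 2 * y := by
      refine mul_right_cancel₀ (b := (4 * 2 ^ m : ℤ)) (by positivity) ?_
      linarith
    -- the inverse of `2 * 2 ^ m + 1` modulo `4 * 2 ^ m` is `1 - 2 * 2 ^ m`
    exact .inr (.inr (.inr (.inr (.inl ⟨_, (h.shift (-y * (1 - 2 * 2 ^ m))).congr_exponents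
      (by simp) ⟨2 ^ m * y, by rw [hn]; ring⟩⟩))))

lemma exists_isCyclicExtension {G : Type*} [Group G] [Finite G] (hG : IsPGroup 2 G)
    (hcard : 2 ^ 4 ≤ Nat.card G) (hmax : ∃ M : Subgroup G, IsCoatom M ∧ IsCyclic M) :
    ∃ (m : ℕ) (k e : ℤ) (a b : G), IsCyclicExtension (2 ^ (m + 3)) k e a b := by
  obtain ⟨M, hM, hcyc⟩ := hmax
  obtain ⟨N, hN⟩ := IsPGroup.iff_card.1 hG
  obtain ⟨j, hj⟩ := IsPGroup.iff_card.1 (hG.to_subgroup M)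
  have h4 : 4 ≤ N := by
    rw [hN] at hcard
    exact (Nat.pow_le_pow_iff_right (by norm_num)).1 hcard
  have hjN : j < N := by
    have hlt : Nat.card M < Nat.card G := by
      refine lt_of_le_of_ne M.card_le_card_group fun heq ↦ hM.1 (M.eq_top_of_card_eq heq)
    rw [hN, hj] at hlt
    exact (Nat.pow_lt_pow_iff_right (by norm_num)).1 hlt
  obtain ⟨K, hK, hMK⟩ := Sylow.exists_subgroup_card_pow_succ (p := 2) (hN ▸ pow_dvd_pow 2 hjN) hj
  have hKtop : K = ⊤ := by
    refine hM.2 K (lt_of_le_of_ne hMK ?_)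
    rintro rfl
    rw [hj] at hK
    have := Nat.pow_right_injective le_rfl hK
    omega
  have hNj : Nat.card G = 2 ^ (j + 1) := by rw [← hK, hKtop, Subgroup.card_top]
  have hidx : M.index = 2 := by
    have := M.card_mul_index
    rw [hNj, hj, pow_succ] at this
    exact Nat.eq_of_mul_eq_mul_left (by positivity) this
  have hnor := Subgroup.normal_of_index_eq_two hidx
  obtain ⟨a, rfl⟩ := M.isCyclic_iff_exists_zpowers_eq_top.1 hcyc
  obtain ⟨b, -, hb⟩ := SetLike.exists_of_lt hM.1.lt_top
  have h3 : j = (j - 3) + 3 := by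
    have : N = j + 1 := Nat.pow_right_injective le_rfl (hN.symm.trans hNj)
    omega
  obtain ⟨e, he⟩ := Subgroup.sq_mem_of_index_two hidx b
  obtain ⟨k, hk⟩ := hnor.conj_mem a (Subgroup.mem_zpowers a) b⁻¹
  rw [inv_inv] at hk
  have ho : orderOf a = 2 ^ (j - 3 + 3) := by rw [← h3, ← hj, Nat.card_zpowers]
  refine ⟨j - 3, k, e, a, b, ⟨ho ▸ pow_orderOf_eq_one a, he.symm, hk.symm⟩, ho, hb, ?_⟩
  rw [eq_top_iff]
  rintro g -
  have ha : a ∈ Subgroup.closure {a, b} := Subgroup.subset_closure (by simp)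
  have hb' : b ∈ Subgroup.closure {a, b} := Subgroup.subset_closure (by simp)
  by_cases hg : g ∈ Subgroup.zpowers a
  · obtain ⟨i, rfl⟩ := hg
    exact zpow_mem ha i
  · obtain ⟨i, hi⟩ := (Subgroup.mul_mem_iff_of_index_two hidx (a := g) (b := b)).2
      ⟨fun h ↦ (hg h).elim, fun h ↦ (hb h).elim⟩
    have : g = a ^ i * b⁻¹ := eq_mul_inv_of_mul_eq hi.symm
    rw [this]
    exact mul_mem (zpow_mem ha i) (inv_mem hb')

/-! ### The classification with automorphism groups -/

theorem proposition2p1 {G : Type*} [Group G] [Finite G] (hG : IsPGroup 2 G)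
    (hcard : 2 ^ 4 ≤ Nat.card G)
    (hmax : ∃ M : Subgroup G, IsCoatom M ∧ IsCyclic M) :
    -- the isomorphism type of `G`, together with its presentation
    ((∃ ℓ : ℕ, 4 ≤ ℓ ∧ Nonempty (G ≃* Cyc (2 ^ ℓ)) ∧
        ∃ a : G, IsPresentation ![a] (cyclicRels ℓ)) ∨
      (∃ ℓ : ℕ, 3 ≤ ℓ ∧ Nonempty (G ≃* Cyc (2 ^ ℓ) × Cyc 2) ∧
        ∃ a b : G, IsPresentation ![a, b] (splitRels ℓ 1)) ∨
      (∃ ℓ : ℕ, 3 ≤ ℓ ∧ Nonempty (G ≃* DihedralGroup (2 ^ ℓ)) ∧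
        ∃ a b : G, IsPresentation ![a, b] (splitRels ℓ (-1))) ∨
      (∃ ℓ : ℕ, 3 ≤ ℓ ∧
        ∃ a b : G, IsCyclicSplit ℓ (2 ^ (ℓ - 1) - 1) a b ∧
          IsPresentation ![a, b] (splitRels ℓ (2 ^ (ℓ - 1) - 1))) ∨
      (∃ ℓ : ℕ, 3 ≤ ℓ ∧
        ∃ a b : G, IsCyclicSplit ℓ (2 ^ (ℓ - 1) + 1) a b ∧
          IsPresentation ![a, b] (splitRels ℓ (2 ^ (ℓ - 1) + 1))) ∨
      (∃ ℓ : ℕ, 3 ≤ ℓ ∧ Nonempty (G ≃* QuaternionGroup (2 ^ (ℓ - 1))) ∧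
        ∃ a c : G, IsPresentation ![a, c] (quaternionRels ℓ))) ∧
    -- the cyclic group
    (∀ (ℓ : ℕ) (a : G), 4 ≤ ℓ → IsPresentation ![a] (cyclicRels ℓ) →
      (∃ ρ₅ ρneg : MulAut G,
        ρ₅ a = a ^ 5 ∧ ρneg a = a⁻¹ ∧
        Subgroup.closure {ρ₅, ρneg} = ⊤) ∧
      Nonempty (MulAut G ≃* Cyc (2 ^ (ℓ - 2)) × Cyc 2)) ∧
    -- the abelian group `Z_{2 ^ ℓ} × Z_2`
    (∀ (ℓ : ℕ) (a b : G), 3 ≤ ℓ → IsPresentation ![a, b] (splitRels ℓ 1) →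
      (∃ ρ₅ ρneg τ σ : MulAut G,
        (ρ₅ a = a ^ 5 ∧ ρ₅ b = b) ∧ (ρneg a = a⁻¹ ∧ ρneg b = b) ∧
        (τ a = a * b ∧ τ b = b) ∧ (σ a = a ∧ σ b = a ^ 2 ^ (ℓ - 1) * b) ∧
        Subgroup.closure {ρ₅, ρneg, τ, σ} = ⊤) ∧
      IsCycCentralD8TimesZ2 ℓ (MulAut G)) ∧
    -- the dihedral group
    (∀ (ℓ : ℕ) (a b : G), 3 ≤ ℓ → IsPresentation ![a, b] (splitRels ℓ (-1)) →
      (∃ ρ₅ ρneg η : MulAut G,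
        (ρ₅ a = a ^ 5 ∧ ρ₅ b = b) ∧ (ρneg a = a⁻¹ ∧ ρneg b = b) ∧
        (η a = a ∧ η b = a * b) ∧
        Subgroup.closure {ρ₅, ρneg, η} = ⊤) ∧
      Nonempty (MulAut G ≃* Holomorph (Cyc (2 ^ ℓ)))) ∧
    -- the semidihedral group
    (∀ (ℓ : ℕ) (a b : G), 3 ≤ ℓ → IsPresentation ![a, b] (splitRels ℓ (2 ^ (ℓ - 1) - 1)) →
      (∃ ρ₅ ρneg η₀ : MulAut G,
        (ρ₅ a = a ^ 5 ∧ ρ₅ b = b) ∧ (ρneg a = a⁻¹ ∧ ρneg b = b) ∧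
        (η₀ a = a ∧ η₀ b = a ^ 2 * b) ∧
        Subgroup.closure {ρ₅, ρneg, η₀} = ⊤) ∧
      Nonempty (MulAut G ≃* HalfHolomorph ℓ)) ∧
    -- the modular group `Z_{2 ^ ℓ} : Z_2`
    (∀ (ℓ : ℕ) (a b : G), 3 ≤ ℓ → IsPresentation ![a, b] (splitRels ℓ (2 ^ (ℓ - 1) + 1)) →
      (∃ ρ₅ ρneg τ σ : MulAut G,
        (ρ₅ a = a ^ 5 ∧ ρ₅ b = b) ∧ (ρneg a = a⁻¹ ∧ ρneg b = b) ∧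
        (τ a = a * b ∧ τ b = b) ∧ (σ a = a ∧ σ b = a ^ 2 ^ (ℓ - 1) * b) ∧
        Subgroup.closure {ρ₅, ρneg, τ, σ} = ⊤) ∧
      IsCycCentralD8TimesZ2 ℓ (MulAut G)) ∧
    -- the generalized quaternion group
    (∀ (ℓ : ℕ) (a c : G), 3 ≤ ℓ → IsPresentation ![a, c] (quaternionRels ℓ) →
      (∃ ρ₅ ρneg η : MulAut G,
        (ρ₅ a = a ^ 5 ∧ ρ₅ c = c) ∧ (ρneg a = a⁻¹ ∧ ρneg c = c) ∧
        (η a = a ∧ η c = a * c) ∧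
        Subgroup.closure {ρ₅, ρneg, η} = ⊤) ∧
      Nonempty (MulAut G ≃* Holomorph (Cyc (2 ^ ℓ)))) ∧
    -- generation by involutions
    (Subgroup.closure {x : G | orderOf x = 2} = ⊤ →
      ∃ ℓ : ℕ, 3 ≤ ℓ ∧ Nonempty (G ≃* DihedralGroup (2 ^ ℓ))) := by
  have hpow (m : ℕ) : (2 : ℤ) ^ (m + 3 - 1) = 4 * 2 ^ m := by
    rw [Nat.add_sub_assoc (by norm_num), pow_add]
    norm_num [mul_comm]
  have hsq (ℓ : ℕ) (hℓ : 3 ≤ ℓ) (ε : ℤ) (hε : ε * ε = 1) :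
      (2 : ℤ) ^ ℓ ∣ (2 ^ (ℓ - 1) + ε) * (2 ^ (ℓ - 1) + ε) - 1 := by
    obtain ⟨m, rfl⟩ := Nat.exists_eq_add_of_le' hℓ
    rw [hpow]
    refine ⟨2 * 2 ^ m + ε, ?_⟩
    linear_combination hε
  obtain ⟨m, k, e, a, b, h⟩ := exists_isCyclicExtension hG hcard hmax
  have hclass := h.classification
  refine ⟨?_, ?_, ?_, ?_, ?_, ?_, ?_, ?_⟩
  · rw [← hpow m] at hclass
    rcases hclass with ⟨c, hc, hc'⟩ | ⟨b, h⟩ | ⟨b, h⟩ | ⟨b, h⟩ | ⟨b, h⟩ | ⟨b, h⟩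
    · obtain ⟨f, -⟩ := exists_cyc_mulEquiv hc hc'
      exact .inl ⟨m + 4, by omega, ⟨f.symm⟩, c, isPresentation_cyclicRels hc hc'⟩
    · obtain ⟨f, -⟩ := h.exists_mulEquiv (Cyc.isCyclicExtension_prod _)
      exact .inr (.inl ⟨m + 3, by omega, ⟨f⟩, a, b, h.isPresentation_splitRels⟩)
    · obtain ⟨f, -⟩ := h.exists_mulEquiv (DihedralGroup.isCyclicExtension _)
      exact .inr (.inr (.inl ⟨m + 3, by omega, ⟨f⟩, a, b, h.isPresentation_splitRels⟩))
    · exact .inr (.inr (.inr (.inl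
        ⟨m + 3, by omega, a, b, h.isCyclicSplit, h.isPresentation_splitRels⟩)))
    · exact .inr (.inr (.inr (.inr (.inl
        ⟨m + 3, by omega, a, b, h.isCyclicSplit, h.isPresentation_splitRels⟩))))
    · have hq := QuaternionGroup.isCyclicExtension (2 ^ (m + 3 - 1))
      replace hq := hq.congr_order (m := 2 ^ (m + 3)) (by rw [← pow_succ']; rfl)
      rw [Nat.cast_pow, Nat.cast_two] at hq
      obtain ⟨f, -⟩ := h.exists_mulEquiv hq
      exact .inr (.inr (.inr (.inr (.inr
        ⟨m + 3, by omega, ⟨f⟩, a, b, h.isPresentation_quaternionRels⟩))))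
  · intro ℓ a hℓ hp
    obtain ⟨ha, hcl⟩ := hp.orderOf_cyclic
    exact mulAut_cyclic ha hcl (by omega)
  · intro ℓ a b hℓ hp
    have h := hp.isCyclicExtension_split (by simp)
    obtain ⟨m, rfl⟩ := Nat.exists_eq_add_of_le' hℓ
    exact (h.congr_exponents (k' := 1 + 4 * 2 ^ m * 0) (e' := 0) (by simp) (by simp)).mulAut_central
  · intro ℓ a b hℓ hp
    exact (hp.isCyclicExtension_split (by simp)).mulAut_dihedral_quaternion hℓ (by simp)
  · intro ℓ a b hℓ hp
    have hk := hsq ℓ hℓ (-1) (by norm_num)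
    rw [← sub_eq_add_neg] at hk
    exact (hp.isCyclicExtension_split hk).mulAut_semidihedral hℓ
  · intro ℓ a b hℓ hp
    have h := hp.isCyclicExtension_split (hsq ℓ hℓ 1 (by norm_num))
    obtain ⟨m, rfl⟩ := Nat.exists_eq_add_of_le' hℓ
    exact (h.congr_exponents (k' := 1 + 4 * 2 ^ m * 1) (e' := 0)
      (by rw [hpow, mul_one, add_comm (1 : ℤ), sub_self]; exact dvd_zero _) (by simp)).mulAut_central
  · intro ℓ a c hℓ hp
    refine (hp.isCyclicExtension_quaternion (by omega)).mulAut_dihedral_quaternion hℓ ?_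
    rw [← pow_succ', Nat.sub_add_cancel (by omega)]
  · intro hinv
    have hn : ((2 ^ (m + 3) : ℕ) : ℤ) = 8 * 2 ^ m := by push_cast; ring
    have h4 : 4 ∣ 2 ^ (m + 3) := ⟨2 * 2 ^ m, by ring⟩
    rcases hclass with ⟨c, hc, hc'⟩ | ⟨b, h⟩ | ⟨b, h⟩ | ⟨b, h⟩ | ⟨b, h⟩ | ⟨b, h⟩
    · exact (closure_involutions_ne_top_of_zpowers_eq_top hc' (n := 2 ^ (m + 4)) hc
        (by have := Nat.one_le_two_pow (n := m); rw [pow_add]; omega) hinv).elim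
    · refine (h.closure_involutions_ne_top h4 (by simp) (fun i hi ↦ ?_) hinv).elim
      obtain ⟨t, ht⟩ := hn ▸ hi
      exact ⟨2 * 2 ^ m * t, by linarith⟩
    · obtain ⟨f, -⟩ := h.exists_mulEquiv (DihedralGroup.isCyclicExtension _)
      exact ⟨m + 3, by omega, ⟨f⟩⟩
    · refine (h.closure_involutions_ne_top h4 (by simp) (fun i hi ↦ ?_) hinv).elim
      obtain ⟨t, ht⟩ := hn ▸ hi
      refine ⟨t, mul_right_cancel₀ (b := (4 * 2 ^ m : ℤ)) (by positivity) ?_⟩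
      linarith
    · refine (h.closure_involutions_ne_top h4 (by simp) (fun i hi ↦ ?_) hinv).elim
      obtain ⟨t, ht⟩ := hn ▸ hi
      exact ⟨2 * 2 ^ m * t - i * 2 ^ m, by linarith⟩
    · refine (h.closure_involutions_ne_top h4 ⟨2 * 2 ^ m, by ring⟩ (fun i hi ↦ ?_) hinv).elim
      obtain ⟨t, ht⟩ := hn ▸ hi
      -- there are no involutions outside `⟨a⟩`
      have h1 : (4 * 2 ^ m : ℤ) * 1 = 4 * 2 ^ m * (2 * t) := by linarith
      have := mul_left_cancel₀ (by positivity) h1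
      omega
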